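/- **Setting.** Let $\xi,\xi_1,\xi_2,\dots$ be i.i.d. data points, let $G(\cdot,\xi)$ be an $\mathbb R^d$-valued (jointly measurable) random function, $g(x)=\mathbb E[G(x,\xi)]$, and let $x^*\in\mathbb R^d$ satisfy $g(x^*)=0$. From an initial point $x_0$ (deterministic, or random and independent of the data) define $$x_{t+1}=x_t-\eta_t\,G(x_t,\xi_{t+1}),\qquad t=0,1,2,\dots,$$ with $\eta_0>0$, $\eta_t=\eta_0t^{-a}$ for $t\ge1$, where $\tfrac12<a<1$. Let $\mathcal F_t=\sigma(x_0,\xi_1,\dots,\xi_t)$ and $\varepsilon_t=g(x_{t-1})-G(x_{t-1},\xi_t)$ for $t\ge1$; $\|\cdot\|$ is the Euclidean or operator norm. **Assumptions.** 1. (Lyapunov function) There are a differentiable $V:\mathbb R^d\to\mathbb R$ and constants $\mu_V,L_V,\lambda_V,\delta_V>0$ with $V(0)=0$; $V(x-x^*)\ge\mu_V\|x-x^*\|^2$ for all $x$; $\|\nabla V(y)-\nabla V(z)\|\le L_V\|y-z\|$ for all $y,z$; $\nabla V(x-x^*)^\top g(x)>0$ for all $x\ne x^*$; and $\nabla V(x-x^*)^\top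 g(x)\ge\lambda_VV(x-x^*)$ whenever $\|x-x^*\|\le\delta_V$. 2. (Local linearity) There are $H\in\mathbb R^{d\times d}$, $L_H\ge0$, $\delta_H>0$, $0<\lambda\le1$ with $\|g(x)-H(x-x^*)\|\le L_H\|x-x^*\|^{1+\lambda}$ whenever $\|x-x^*\|\le\delta_H$, and every eigenvalue of $H$ has positive real part. 3. (Lipschitzness) For some $L_G>0$ and all $x,y$: $\big(\mathbb E\|G(x,\xi)-G(y,\xi)\|^2\big)^{1/2}\le L_G\|x-y\|$. 4. (Noise) - For some $L_\varepsilon>0$ and all $t\ge1$, almost surely $\mathbb E(\|\varepsilon_t\|^2\mid\mathcal F_{t-1})+\|g(x_{t-1})\|^2\le L_\varepsilon(1+\|x_{t-1}-x^*\|^2)$. - $\varepsilon_t=\varepsilon_t(0)+\zeta_t(x_{t-1})$ with $\varepsilon_t(0)$ square integrable, where: $\mathbb E(\varepsilon_t(0)\mid\mathcal F_{t-1})=0$ a.s.; $\mathbb E(\varepsilon_t(0)\varepsilon_t(0)^\top\mid\mathcal F_{t-1})\to S$ in probability as $t\to\infty$, with $S$ symmetric positive definite; $\sup_{t\ge1}\mathbb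 E(\|\varepsilon_t(0)\|^2\mathbf 1\{\|\varepsilon_t(0)\|>C\}\mid\mathcal F_{t-1})\to0$ in probability as $C\to\infty$; and for all large $t$, $\mathbb E(\|\zeta_t(x_{t-1})\|^2\mid\mathcal F_{t-1})\le\delta(x_{t-1}-x^*)$ a.s. for a function $\delta$ with $\delta(\Delta)\to0$ as $\Delta\to0$ (including $\delta(0)=0$). - For some $p>1$ and $C_\varepsilon<\infty$: $\mathbb E\|\varepsilon_t\|^{2p}\le C_\varepsilon$ for all $t\ge1$ and $\mathbb E\|G(x^*,\xi)\|^{2p}\le C_\varepsilon$. 5. (Rate condition) Either $L_H=0$ and $0<a<\frac{p-1}p$; or $p>\frac{1+\lambda}\lambda$ and $\frac1{1+\lambda}<a<\frac{p-1}p$. 6. (Estimate of $H$) $\bar H(\cdot,\xi)$ is a (jointly measurable) random function with values in $\mathbb R^{d\times d}$ such that $\mathbb E\,\bar H(x^*,\xi)=H$, $\mathbb E\|\bar H(x^*,\xi)\|^{\bar p}<\infty$ for some $\bar p>1$, and, for some $L_{\bar H}>0$ and all $x,y$, $\big(\mathbb E\|\bar H(x,\xi)-\bar H(y,\xi)\|^2\big)^{1/2}\le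 L_{\bar H}\|x-y\|$. **Proposition.** Put $$\widehat H_t=\frac1t\sum_{j=0}^{t-1}\bar H(x_j,\xi_{j+1}),\qquad \widehat S_t=\frac1t\sum_{j=0}^{t-1}G(x_j,\xi_{j+1})G(x_j,\xi_{j+1})^\top .$$ Then, almost surely, $\widehat H_t$ is invertible for all large $t$, and $$\widehat H_t^{-1}\widehat S_t\widehat H_t^{-1}=H^{-1}SH^{-1}+\tilde o\Big(t^{-\min\{1-1/\bar p,\;a/2\}}\Big)\quad\text{a.s.},$$ where $Y_t=\tilde o(r_t)$ a.s. means that for some (non-random) $k\ge0$, almost surely $Y_t=o\big(r_t(\log t)^k\big)$ as $t\to\infty$. -/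

import Mathlib

open MeasureTheory ProbabilityTheory Filter Topology
open scoped Matrix.Norms.L2Operator

noncomputable section

namespace SA

/-- `ℝ^d` with the Euclidean norm. -/
abbrev Vec (d : ℕ) := EuclideanSpace ℝ (Fin d)

/-- Real `d × d` matrices; the norm in force is the `ℓ²` operator norm. -/
abbrev Mat (d : ℕ) := Matrix (Fin d) (Fin d) ℝ

variable {d : ℕ} {Ω Ξ : Type*} [MeasurableSpace Ω] [MeasurableSpace Ξ]

/-- The outer product `u vᵀ`. -/
def outer (u v : Vec d) : Mat d := Matrix.of fun i k => u i * v k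

/-- `g(x) = E[G(x, ξ)]`, where `ν` is the law of a data point `ξ`. -/
def meanField (ν : Measure Ξ) (G : Vec d → Ξ → Vec d) (x : Vec d) : Vec d :=
  ∫ s, G x s ∂ν

/-- `η_t = η₀ t^{-a}` for `t ≥ 1`, and `η₀` itself at `t = 0`. -/
def stepSize (η₀ a : ℝ) (t : ℕ) : ℝ :=
  if t = 0 then η₀ else η₀ * (t : ℝ) ^ (-a)

/-- The recursion `x_{t+1} = x_t - η_t G(x_t, ξ_{t+1})`. The data are indexed from `0`:
`ξ t` is the data point `ξ_{t+1}` that is used in the step from `x_t` to `x_{t+1}`. -/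
def iter (G : Vec d → Ξ → Vec d) (η : ℕ → ℝ) (x₀ : Ω → Vec d) (ξ : ℕ → Ω → Ξ) :
    ℕ → Ω → Vec d
  | 0 => x₀
  | t + 1 => fun ω => iter G η x₀ ξ t ω - η t • G (iter G η x₀ ξ t ω) (ξ t ω)

/-- `ℱ_t`, generated by `x_0` and the first `t` data points. -/
@[reducible] def history (x₀ : Ω → Vec d) (ξ : ℕ → Ω → Ξ) (t : ℕ) : MeasurableSpace Ω :=
  MeasurableSpace.comap x₀ inferInstance ⊔
    ⨆ i ∈ Finset.range t, MeasurableSpace.comap (ξ i) inferInstance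

/-- `noise … t` is `ε_{t+1} = g(x_t) - G(x_t, ξ_{t+1})`. -/
def noise (ν : Measure Ξ) (G : Vec d → Ξ → Vec d) (η : ℕ → ℝ) (x₀ : Ω → Vec d)
    (ξ : ℕ → Ω → Ξ) (t : ℕ) (ω : Ω) : Vec d :=
  meanField ν G (iter G η x₀ ξ t ω) - G (iter G η x₀ ξ t ω) (ξ t ω)

/-- The data are i.i.d. with law `ν` and independent of the initial point. -/
structure IsDataStream (μ : Measure Ω) (ν : Measure Ξ) (x₀ : Ω → Vec d) (ξ : ℕ → Ω → Ξ) :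
    Prop where
  measurable_init : Measurable x₀
  measurable_data : ∀ i, Measurable (ξ i)
  law : ∀ i, μ.map (ξ i) = ν
  indep : iIndepFun ξ μ
  indep_init : IndepFun x₀ (fun ω i => ξ i ω) μ

/-- Existence of a Lyapunov function for the root `xs` of `g`. -/
def HasLyapunov (g : Vec d → Vec d) (xs : Vec d) : Prop :=
  ∃ V : Vec d → ℝ, Differentiable ℝ V ∧ V 0 = 0 ∧
    (∃ μV > 0, ∀ x, μV * ‖x - xs‖ ^ 2 ≤ V (x - xs)) ∧
    (∃ LV > 0, ∀ y z, ‖gradient V y - gradient V z‖ ≤ LV * ‖y - z‖) ∧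
    (∀ x, x ≠ xs → 0 < inner ℝ (gradient V (x - xs)) (g x)) ∧
    (∃ δV > 0, ∃ lV > 0, ∀ x, ‖x - xs‖ ≤ δV →
      lV * V (x - xs) ≤ inner ℝ (gradient V (x - xs)) (g x))

/-- Local linearity of `g` at `xs` with matrix `H`, constant `LH` and exponent `1 + lam`; all
complex eigenvalues of `H` have positive real part. -/
def IsLocallyLinear (g : Vec d → Vec d) (xs : Vec d) (H : Mat d) (LH lam : ℝ) : Prop :=
  0 ≤ LH ∧ 0 < lam ∧ lam ≤ 1 ∧
    (∃ δH > 0, ∀ x, ‖x - xs‖ ≤ δH →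
      ‖g x - Matrix.toEuclideanLin H (x - xs)‖ ≤ LH * ‖x - xs‖ ^ (1 + lam)) ∧
    ∀ z ∈ spectrum ℂ (H.map (algebraMap ℝ ℂ)), 0 < z.re

/-- Lipschitz continuity in mean square:
`sqrt (E ‖F(x, ξ) - F(y, ξ)‖²) ≤ L ‖x - y‖` for a constant `L > 0`. -/
def IsMeanSquareLipschitz {E : Type*} [NormedAddCommGroup E] (ν : Measure Ξ)
    (F : Vec d → Ξ → E) : Prop :=
  ∃ L > 0, ∀ x y : Vec d,
    eLpNorm (fun s => F x s - F y s) 2 ν ≤ ENNReal.ofReal (L * ‖x - y‖)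

/-- The decomposition `ε_{t+1} = ε_{t+1}(0) + ζ_{t+1}(x_t)` of a noise sequence `ε` along the
process `x`, with respect to the history `ℱ`; `e₀ t` and `ζ t` stand for `ε_{t+1}(0)` and
`ζ_{t+1}`. -/
structure IsNoiseDecomposition (μ : Measure Ω) (ℱ : ℕ → MeasurableSpace Ω)
    (x : ℕ → Ω → Vec d) (xs : Vec d) (ε : ℕ → Ω → Vec d) (S : Mat d)
    (e₀ : ℕ → Ω → Vec d) (ζ : ℕ → Vec d → Ω → Vec d) : Prop where
  decomp : ∀ t, ∀ᵐ ω ∂μ, ε t ω = e₀ t ω + ζ t (x t ω) ω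
  memLp : ∀ t, MemLp (e₀ t) 2 μ
  centered : ∀ t, μ[e₀ t | ℱ t] =ᵐ[μ] 0
  covariance : ∀ i k,
    TendstoInMeasure μ (fun t => μ[fun ω => outer (e₀ t ω) (e₀ t ω) i k | ℱ t]) atTop
      (fun _ => S i k)
  uniformTail : ∀ r > 0, Tendsto (fun C : ℝ => μ {ω | r ≤ ⨆ t,
      ENNReal.ofReal ((μ[{ω' | C < ‖e₀ t ω'‖}.indicator fun ω' => ‖e₀ t ω'‖ ^ 2 | ℱ t]) ω)})
    atTop (𝓝 0)
  remainder : ∃ δ : Vec d → ℝ, Tendsto δ (𝓝 0) (𝓝 0) ∧ ∀ᶠ t in atTop,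
    ∀ᵐ ω ∂μ, (μ[fun ω' => ‖ζ t (x t ω') ω'‖ ^ 2 | ℱ t]) ω ≤ δ (x t ω - xs)

/-- The conditions on the noise of the stochastic approximation recursion, with limiting
covariance `S` and moment exponent `2p`. -/
structure NoiseCondition (μ : Measure Ω) (ν : Measure Ξ) (G : Vec d → Ξ → Vec d)
    (η : ℕ → ℝ) (x₀ : Ω → Vec d) (ξ : ℕ → Ω → Ξ) (xs : Vec d) (S : Mat d) (p : ℝ) :
    Prop where
  growth : ∃ Lε > 0, ∀ t, ∀ᵐ ω ∂μ,
    (μ[fun ω' => ‖noise ν G η x₀ ξ t ω'‖ ^ 2 | history x₀ ξ t]) ω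
        + ‖meanField ν G (iter G η x₀ ξ t ω)‖ ^ 2
      ≤ Lε * (1 + ‖iter G η x₀ ξ t ω - xs‖ ^ 2)
  posDef : S.PosDef
  decomposition : ∃ e₀ ζ, IsNoiseDecomposition μ (history x₀ ξ) (iter G η x₀ ξ) xs
    (noise ν G η x₀ ξ) S e₀ ζ
  one_lt : 1 < p
  moment : ∃ Cε : ℝ,
    (∀ t, ∫⁻ ω, ‖noise ν G η x₀ ξ t ω‖ₑ ^ (2 * p) ∂μ ≤ ENNReal.ofReal Cε) ∧
      ∫⁻ s, ‖G xs s‖ₑ ^ (2 * p) ∂ν ≤ ENNReal.ofReal Cε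

/-- The rate condition: linear case or nonlinear case. -/
def RateCondition (lam p a LH : ℝ) : Prop :=
  (LH = 0 ∧ 0 < a ∧ a < (p - 1) / p) ∨
    ((1 + lam) / lam < p ∧ 1 / (1 + lam) < a ∧ a < (p - 1) / p)

/-- `Hbar(xs, ξ)` has mean `H` and a finite moment of order `pbar > 1`. -/
def IsUnbiasedEstimate (ν : Measure Ξ) (Hbar : Vec d → Ξ → Mat d) (xs : Vec d) (H : Mat d)
    (pbar : ℝ) : Prop :=
  1 < pbar ∧ MemLp (Hbar xs) (ENNReal.ofReal pbar) ν ∧ ∫ s, Hbar xs s ∂ν = H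

/-- `Ĥ_t = (1/t) ∑_{j<t} Hbar(x_j, ξ_{j+1})`. -/
def hatH (Hbar : Vec d → Ξ → Mat d) (x : ℕ → Ω → Vec d) (ξ : ℕ → Ω → Ξ) (t : ℕ) (ω : Ω) :
    Mat d :=
  (t : ℝ)⁻¹ • ∑ j ∈ Finset.range t, Hbar (x j ω) (ξ j ω)

/-- `Ŝ_t = (1/t) ∑_{j<t} G(x_j, ξ_{j+1}) G(x_j, ξ_{j+1})ᵀ`. -/
def hatS (G : Vec d → Ξ → Vec d) (x : ℕ → Ω → Vec d) (ξ : ℕ → Ω → Ξ) (t : ℕ) (ω : Ω) :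
    Mat d :=
  (t : ℝ)⁻¹ • ∑ j ∈ Finset.range t, outer (G (x j ω) (ξ j ω)) (G (x j ω) (ξ j ω))

/-- `Y_t = õ(r_t)` almost surely: for some power `k`, almost surely `Y_t = o(r_t (log t)^k)`. -/
def IsSoftLittleOAS {E : Type*} [NormedAddCommGroup E] (μ : Measure Ω) (Y : ℕ → Ω → E)
    (r : ℕ → ℝ) : Prop :=
  ∃ k : ℕ, ∀ᵐ ω ∂μ,
    (fun t => Y t ω) =o[atTop] fun t : ℕ => r t * Real.log (t : ℝ) ^ k

end SA

end

/-! Both estimators average quantities `F (x j) (ξ j)` along the trajectory, where `F` is an entry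
of `Hbar` or a product of two coordinates of `G`. Each average is compared with the average of the
i.i.d. values `F xs (ξ j)`. The error splits into a replacement error, of order `t^{-a/2}`, and a
fluctuation at the root, of order `t^{-(1-1/q)}` when `F xs` has a moment of order `q ≤ 2`, up to
logarithms.

Replacement. For a mean square Lipschitz `F`, the square of `F (x j) (ξ j) - F xs (ξ j)` has
conditional mean at most `L² ‖x j - xs‖²` given the past. The Lyapunov drift makes the mean of `‖x j
- xs‖²` of order `j^{-a}`, but only on the event that the path remains in the ball where the drift
dominates `V` (`exists_lintegral_stayClose_le`). Robbins–Siegmund gives `x j → xs` almost surely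
(`ae_tendsto_iter`), so almost every path lies in such an event from some time on. Summing the
squares against suitable weights turns the bound in mean into a pathwise bound `O(t^{1-a} log² t)`
(`ae_exists_sum_sq_le`), and Cauchy–Schwarz turns this into `O(t^{1-a/2} log² t)` for the
differences themselves. Products of coordinates of `G` are expanded around the root and treated in
the same way.

Fluctuation. Truncation and martingale convergence give a Marcinkiewicz–Zygmund law
(`ae_exists_abs_sum_sub_le`). For `Hbar` it is used with `q = min pbar 2`. For `G`, the conditions
`1/2 < a < 1 - 1/p` force `p > 2`, so products of coordinates have a variance and fluctuate at order
`t^{-1/2}`, which is below `t^{-a/2}`.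

Identification. The averages for `hatS` are centred at the second moment of `G xs`. It equals `S`
because the noise approaches `-G xs (ξ t)` in conditional mean square (`covariance_eq`). Finally `H`
is invertible, since `0` is not in its spectrum, and rates pass through inversion and products
(`isLittleO_inv_mul_mul_inv`). -/

noncomputable section

namespace SA

variable {d : ℕ} {Ω Ξ : Type*} [MeasurableSpace Ω] [MeasurableSpace Ξ]

/-! ### Histories, independence of the next data point, and freezing. -/

/-- If `X` is independent of `(Y, Z)`, and `Y` of `Z`, then `(X, Y)` is independent of `Z`. -/
theorem indepFun_prodMk_of_indepFun {α β γ : Type*} [MeasurableSpace α] [MeasurableSpace β]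
    [MeasurableSpace γ] {μ : Measure Ω} [IsProbabilityMeasure μ] {X : Ω → α} {Y : Ω → β}
    {Z : Ω → γ} (hX : Measurable X) (hY : Measurable Y) (hZ : Measurable Z)
    (h : IndepFun X (fun ω => (Y ω, Z ω)) μ) (h' : IndepFun Y Z μ) :
    IndepFun (fun ω => (X ω, Y ω)) Z μ := by
  have := Measure.isProbabilityMeasure_map (μ := μ) hX.aemeasurable
  have := Measure.isProbabilityMeasure_map (μ := μ) hY.aemeasurable
  have := Measure.isProbabilityMeasure_map (μ := μ) hZ.aemeasurable
  have hXY : IndepFun X Y μ := h.comp measurable_id measurable_fst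
  rw [indepFun_iff_map_prod_eq_prod_map_map (by fun_prop) (by fun_prop)] at h h' hXY ⊢
  have key := congrArg (Measure.map MeasurableEquiv.prodAssoc.symm) h
  rw [Measure.map_map (by fun_prop) (by fun_prop), h', ← Measure.prodAssoc_prod,
    Measure.map_map (by fun_prop) (by fun_prop)] at key
  rw [hXY]
  simpa [Function.comp_def, MeasurableEquiv.prodAssoc] using key

theorem IsDataStream.history_le {μ : Measure Ω} {ν : Measure Ξ} {x₀ : Ω → Vec d}
    {ξ : ℕ → Ω → Ξ} (h : IsDataStream μ ν x₀ ξ) (t : ℕ) :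
    history x₀ ξ t ≤ ‹MeasurableSpace Ω› :=
  sup_le h.measurable_init.comap_le (iSup₂_le fun i _ => (h.measurable_data i).comap_le)

omit [MeasurableSpace Ω] in
theorem history_mono (x₀ : Ω → Vec d) (ξ : ℕ → Ω → Ξ) : Monotone (history x₀ ξ) :=
  fun _ _ hst => sup_le_sup le_rfl
    (biSup_mono fun _ hi => Finset.mem_range.2 ((Finset.mem_range.1 hi).trans_le hst))

/-- The histories as a filtration. -/
def IsDataStream.filtration {μ : Measure Ω} {ν : Measure Ξ} {x₀ : Ω → Vec d}
    {ξ : ℕ → Ω → Ξ} (h : IsDataStream μ ν x₀ ξ) : Filtration ℕ ‹MeasurableSpace Ω› where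
  seq := history x₀ ξ
  mono' := history_mono x₀ ξ
  le' := h.history_le

omit [MeasurableSpace Ω] in
theorem measurable_init_history (x₀ : Ω → Vec d) (ξ : ℕ → Ω → Ξ) (t : ℕ) :
    Measurable[history x₀ ξ t] x₀ :=
  (comap_measurable x₀).mono le_sup_left le_rfl

omit [MeasurableSpace Ω] in
theorem measurable_data_history (x₀ : Ω → Vec d) (ξ : ℕ → Ω → Ξ) {i t : ℕ} (hit : i < t) :
    Measurable[history x₀ ξ t] (ξ i) :=
  (comap_measurable (ξ i)).mono
    ((le_iSup₂ (f := fun j (_ : j ∈ Finset.range t) =>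
      MeasurableSpace.comap (ξ j) inferInstance) i (Finset.mem_range.2 hit)).trans le_sup_right)
    le_rfl

omit [MeasurableSpace Ω] in
theorem measurable_iter {G : Vec d → Ξ → Vec d} (hG : Measurable (Function.uncurry G))
    (η : ℕ → ℝ) (x₀ : Ω → Vec d) (ξ : ℕ → Ω → Ξ) (t : ℕ) :
    Measurable[history x₀ ξ t] (iter G η x₀ ξ t) := by
  induction t with
  | zero => exact measurable_init_history x₀ ξ 0
  | succ t ih =>
    have h1 : Measurable[history x₀ ξ (t + 1)] (iter G η x₀ ξ t) :=
      ih.mono (history_mono x₀ ξ t.le_succ) le_rfl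
    have h2 := measurable_data_history x₀ ξ t.lt_succ_self
    exact h1.sub ((hG.comp (h1.prodMk h2)).const_smul (η t))

/-- The history is generated by the pair of `x₀` and the first `t` data points. These data points
are independent of `ξ t`, and `x₀` is independent of the whole stream, so the two independences
combine. -/
theorem IsDataStream.indep_history {μ : Measure Ω} [IsProbabilityMeasure μ] {ν : Measure Ξ}
    {x₀ : Ω → Vec d} {ξ : ℕ → Ω → Ξ} (h : IsDataStream μ ν x₀ ξ) (t : ℕ) :
    Indep (history x₀ ξ t) (MeasurableSpace.comap (ξ t) inferInstance) μ := by
  let Y : Ω → (Finset.range t → Ξ) := fun ω i => ξ i ω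
  have hY : Measurable Y := measurable_pi_lambda _ fun i => h.measurable_data i
  have h1 : IndepFun Y (ξ t) μ := by
    have := h.indep.indepFun_finset (Finset.range t) {t} (by simp) h.measurable_data
    exact this.comp measurable_id (measurable_pi_apply ⟨t, by simp⟩)
  have h2 : IndepFun x₀ (fun ω => (Y ω, ξ t ω)) μ := by
    refine h.indep_init.comp (φ := id) (ψ := fun z : ℕ → Ξ =>
      ((fun i => z i : Finset.range t → Ξ), z t)) measurable_id ?_
    exact (measurable_pi_lambda _ fun i => measurable_pi_apply _).prodMk (measurable_pi_apply _)
  have h3 := indepFun_prodMk_of_indepFun h.measurable_init hY (h.measurable_data t) h2 h1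
  refine indep_of_indep_of_le_left h3 (sup_le ?_ (iSup₂_le fun i hi => ?_))
  · exact (measurable_fst.comp (comap_measurable fun ω => (x₀ ω, Y ω))).comap_le
  · exact ((measurable_pi_apply (⟨i, hi⟩ : Finset.range t)).comp
      (measurable_snd.comp (comap_measurable fun ω => (x₀ ω, Y ω)))).comap_le

/-- Freezing lemma: an independent variable may be integrated out first. -/
theorem lintegral_comp_of_indepFun {α : Type*} [MeasurableSpace α] {μ : Measure Ω}
    [IsProbabilityMeasure μ] {ν : Measure Ξ} [IsProbabilityMeasure ν] {W : Ω → α} {Z : Ω → Ξ}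
    (hW : Measurable W) (hZ : Measurable Z) (hlaw : μ.map Z = ν) (hind : IndepFun W Z μ)
    {f : α → Ξ → ENNReal} (hf : Measurable (Function.uncurry f)) :
    ∫⁻ ω, f (W ω) (Z ω) ∂μ = ∫⁻ ω, ∫⁻ s, f (W ω) s ∂ν ∂μ := by
  have h2 := (indepFun_iff_map_prod_eq_prod_map_map hW.aemeasurable hZ.aemeasurable).1 hind
  have h3 : ∫⁻ ω, f (W ω) (Z ω) ∂μ
      = ∫⁻ q, Function.uncurry f q ∂(μ.map fun ω => (W ω, Z ω)) := by
    rw [lintegral_map hf (hW.prodMk hZ)]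
    rfl
  rw [h3, h2, hlaw, lintegral_prod _ hf.aemeasurable,
    lintegral_map hf.lintegral_prod_right' hW]
  rfl

/-- The indicator of `A` is attached to `X` as a second component of the frozen variable. This
serves as a conditional expectation identity that needs no integrability. -/
theorem IsDataStream.lintegral_data {μ : Measure Ω} [IsProbabilityMeasure μ] {ν : Measure Ξ}
    [IsProbabilityMeasure ν] {x₀ : Ω → Vec d} {ξ : ℕ → Ω → Ξ} (h : IsDataStream μ ν x₀ ξ)
    (t : ℕ) {X : Ω → Vec d} (hX : Measurable[history x₀ ξ t] X) {f : Vec d → Ξ → ENNReal}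
    (hf : Measurable (Function.uncurry f)) {A : Set Ω} (hA : MeasurableSet[history x₀ ξ t] A) :
    ∫⁻ ω in A, f (X ω) (ξ t ω) ∂μ = ∫⁻ ω in A, ∫⁻ s, f (X ω) s ∂ν ∂μ := by
  have hA' := h.history_le t A hA
  let W : Ω → Vec d × ENNReal := fun ω => (X ω, A.indicator 1 ω)
  have hW : Measurable[history x₀ ξ t] W := hX.prodMk
    ((@measurable_const _ _ _ (history x₀ ξ t) (1 : ENNReal)).indicator hA)
  have hind : IndepFun W (ξ t) μ :=
    indep_of_indep_of_le_left (h.indep_history t) hW.comap_le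
  have hf' : Measurable (Function.uncurry fun (w : Vec d × ENNReal) s => w.2 * f w.1 s) :=
    (measurable_snd.comp measurable_fst).mul
      (hf.comp ((measurable_fst.comp measurable_fst).prodMk measurable_snd))
  have key := lintegral_comp_of_indepFun (hW.mono (h.history_le t) le_rfl)
    (h.measurable_data t) (h.law t) hind hf'
  rw [← lintegral_indicator hA', ← lintegral_indicator hA']
  convert key using 2 <;> funext ω <;> by_cases hω : ω ∈ A <;> simp [W, hω]

/-! ### Functions with Lipschitz gradient. -/

section Lyapunov

variable {E : Type*} [NormedAddCommGroup E] [InnerProductSpace ℝ E] [CompleteSpace E]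

/-- Descent lemma for a function with Lipschitz gradient. -/
theorem le_of_lipschitz_gradient {V : E → ℝ} (hV : Differentiable ℝ V) {L : ℝ} (hL : 0 ≤ L)
    (hlip : ∀ y z, ‖gradient V y - gradient V z‖ ≤ L * ‖y - z‖) (y h : E) :
    V (y + h) ≤ V y + inner ℝ (gradient V y) h + L * ‖h‖ ^ 2 := by
  have hfd : ∀ z, fderiv ℝ V z = InnerProductSpace.toDual ℝ E (gradient V z) := fun z => by
    simp [gradient]
  -- Mean value inequality for `V` minus its linear part at `y`: on the segment the derivative moves
  -- by at most `L * ‖h‖`. The factor one half of the sharp bound is not needed.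
  have key := (convex_segment y (y + h)).norm_image_sub_le_of_norm_fderiv_le' (f := V)
    (φ := fderiv ℝ V y) (C := L * ‖h‖) (fun z _ => hV z) (fun z hz => ?_)
    (left_mem_segment ℝ y (y + h)) (right_mem_segment ℝ y (y + h))
  · rw [add_sub_cancel_left, hfd, InnerProductSpace.toDual_apply_apply, Real.norm_eq_abs] at key
    nlinarith [le_abs_self (V (y + h) - V y - inner ℝ (gradient V y) h)]
  · rw [hfd, hfd, ← map_sub, LinearIsometryEquiv.norm_map]
    refine (hlip z y).trans ?_
    gcongr
    obtain ⟨c, hc, rfl⟩ := (segment_eq_image' ℝ y (y + h)) ▸ hz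
    simp only [add_sub_cancel_left, norm_smul, Real.norm_eq_abs, abs_of_nonneg hc.1]
    exact mul_le_of_le_one_left (norm_nonneg _) hc.2

theorem gradient_eq_zero_of_isMinOn {V : E → ℝ} {y : E} (h : ∀ z, V y ≤ V z) :
    gradient V y = 0 := by
  have : IsLocalMin V y := Eventually.of_forall h
  simp [gradient, this.fderiv_eq_zero]

end Lyapunov

/-! ### Mean square Lipschitz fields and the one-step Lyapunov drift. -/

section MeanSquare

variable {E : Type*} [NormedAddCommGroup E] {ν : Measure Ξ}

theorem lintegral_enorm_sq_le_of_eLpNorm_le {f : Ξ → E} {c : ℝ} (hc : 0 ≤ c)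
    (h : eLpNorm f 2 ν ≤ ENNReal.ofReal c) :
    ∫⁻ s, ‖f s‖ₑ ^ 2 ∂ν ≤ ENNReal.ofReal (c ^ 2) := by
  have h1 := eLpNorm_nnreal_pow_eq_lintegral (f := f) (μ := ν) (p := 2) two_ne_zero
  simp only [NNReal.coe_ofNat, ENNReal.coe_ofNat, ENNReal.rpow_ofNat] at h1
  rw [← h1, ENNReal.ofReal_pow hc]
  gcongr

theorem integral_norm_sq_le_of_eLpNorm_le {f : Ξ → E} (hf : AEStronglyMeasurable f ν) {c : ℝ}
    (hc : 0 ≤ c) (h : eLpNorm f 2 ν ≤ ENNReal.ofReal c) : ∫ s, ‖f s‖ ^ 2 ∂ν ≤ c ^ 2 := by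
  rw [integral_eq_lintegral_of_nonneg_ae (Eventually.of_forall fun _ => by positivity)
    (by exact hf.norm.pow 2)]
  refine ENNReal.toReal_le_of_le_ofReal (sq_nonneg c) ?_
  convert lintegral_enorm_sq_le_of_eLpNorm_le hc h using 3 with s
  rw [ENNReal.ofReal_pow (norm_nonneg _), ofReal_norm]

variable {G : Vec d → Ξ → Vec d} {L : ℝ} {xs : Vec d}

theorem memLp_two_of_lipschitz (hG : Measurable (Function.uncurry G))
    (hlip : ∀ x y, eLpNorm (fun s => G x s - G y s) 2 ν ≤ ENNReal.ofReal (L * ‖x - y‖))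
    (hxs : MemLp (G xs) 2 ν) (x : Vec d) : MemLp (G x) 2 ν := by
  have h1 : MemLp (fun s => G x s - G xs s) 2 ν :=
    ⟨((hG.comp measurable_prodMk_left).sub
      (hG.comp measurable_prodMk_left)).aestronglyMeasurable,
      (hlip x xs).trans_lt ENNReal.ofReal_lt_top⟩
  simpa [Pi.add_def] using h1.add hxs

/-- The norm of an integral is at most the `L¹` norm, which is at most the `L²` norm under a
probability measure. -/
theorem norm_meanField_sub_le [IsProbabilityMeasure ν] (hG : Measurable (Function.uncurry G))
    (hL : 0 ≤ L)
    (hlip : ∀ x y, eLpNorm (fun s => G x s - G y s) 2 ν ≤ ENNReal.ofReal (L * ‖x - y‖))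
    (hxs : MemLp (G xs) 2 ν) (x y : Vec d) :
    ‖meanField ν G x - meanField ν G y‖ ≤ L * ‖x - y‖ := by
  have hx := memLp_two_of_lipschitz hG hlip hxs
  have hm : ∀ x, Measurable (G x) := fun x => hG.comp measurable_prodMk_left
  unfold meanField
  rw [← integral_sub ((hx x).integrable one_le_two) ((hx y).integrable one_le_two)]
  have h1 : ‖∫ s, (G x s - G y s) ∂ν‖ₑ ≤ ENNReal.ofReal (L * ‖x - y‖) := by
    refine (enorm_integral_le_lintegral_enorm _).trans ?_
    rw [← eLpNorm_one_eq_lintegral_enorm]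
    exact (eLpNorm_le_eLpNorm_of_exponent_le one_le_two
      ((hm x).sub (hm y)).aestronglyMeasurable).trans (hlip x y)
  rw [← ofReal_norm] at h1
  exact (ENNReal.ofReal_le_ofReal_iff (by positivity)).1 h1

theorem integral_norm_sq_le (hG : Measurable (Function.uncurry G)) (hL : 0 ≤ L)
    (hlip : ∀ x y, eLpNorm (fun s => G x s - G y s) 2 ν ≤ ENNReal.ofReal (L * ‖x - y‖))
    (hxs : MemLp (G xs) 2 ν) (x : Vec d) :
    ∫ s, ‖G x s‖ ^ 2 ∂ν ≤ 2 * (L * ‖x - xs‖) ^ 2 + 2 * ∫ s, ‖G xs s‖ ^ 2 ∂ν := by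
  have hx := memLp_two_of_lipschitz hG hlip hxs
  have h1 : MemLp (fun s => G x s - G xs s) 2 ν := (hx x).sub hxs
  have i1 : Integrable (fun s => ‖G x s - G xs s‖ ^ 2) ν := h1.integrable_norm_pow two_ne_zero
  have i2 : Integrable (fun s => ‖G xs s‖ ^ 2) ν := hxs.integrable_norm_pow two_ne_zero
  have i3 : Integrable (fun s => ‖G x s‖ ^ 2) ν := (hx x).integrable_norm_pow two_ne_zero
  have h2 := integral_norm_sq_le_of_eLpNorm_le h1.1 (by positivity) (hlip x xs)
  calc ∫ s, ‖G x s‖ ^ 2 ∂ν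
      ≤ ∫ s, (2 * ‖G x s - G xs s‖ ^ 2 + 2 * ‖G xs s‖ ^ 2) ∂ν := by
        refine integral_mono i3 ((i1.const_mul 2).add (i2.const_mul 2)) fun s => ?_
        have := norm_add_le (G x s - G xs s) (G xs s)
        rw [sub_add_cancel] at this
        have h0 := norm_nonneg (G x s)
        simp only
        nlinarith [sq_nonneg (‖G x s - G xs s‖ - ‖G xs s‖)]
    _ = 2 * ∫ s, ‖G x s - G xs s‖ ^ 2 ∂ν + 2 * ∫ s, ‖G xs s‖ ^ 2 ∂ν := by
        rw [integral_add (i1.const_mul 2) (i2.const_mul 2), integral_const_mul,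
          integral_const_mul]
    _ ≤ _ := by gcongr

/-- Expected decrease of the Lyapunov function in one step of the recursion. -/
theorem exists_lyapunov_step [IsProbabilityMeasure ν] (hG : Measurable (Function.uncurry G))
    (hL : 0 ≤ L)
    (hlip : ∀ x y, eLpNorm (fun s => G x s - G y s) 2 ν ≤ ENNReal.ofReal (L * ‖x - y‖))
    (hxs : MemLp (G xs) 2 ν) {V : Vec d → ℝ} (hV : Differentiable ℝ V) {μV LV : ℝ}
    (hμV : 0 < μV) (hVlow : ∀ y, μV * ‖y‖ ^ 2 ≤ V y) (hLV : 0 ≤ LV)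
    (hVlip : ∀ y z, ‖gradient V y - gradient V z‖ ≤ LV * ‖y - z‖)
    (hpos : ∀ x, 0 ≤ inner ℝ (gradient V (x - xs)) (meanField ν G x)) :
    ∃ C, 0 ≤ C ∧ ∀ η, 0 ≤ η → ∀ x,
      ∫⁻ s, ENNReal.ofReal (V (x - η • G x s - xs)) ∂ν
          + ENNReal.ofReal (η * inner ℝ (gradient V (x - xs)) (meanField ν G x))
        ≤ ENNReal.ofReal ((1 + C * η ^ 2) * V (x - xs) + C * η ^ 2) := by
  set m := ∫ s, ‖G xs s‖ ^ 2 ∂ν with hm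
  have hm0 : 0 ≤ m := integral_nonneg fun s => by positivity
  have hVnn : ∀ y, 0 ≤ V y := fun y => (by positivity : 0 ≤ μV * ‖y‖ ^ 2).trans (hVlow y)
  -- `LV * η²` multiplies the second moment of `G x` in the descent lemma, and that moment is at
  -- most `(2 L² / μV + 2 m) (V + 1)`.
  refine ⟨LV * (2 * L ^ 2 / μV + 2 * m), by positivity, fun η hη x => ?_⟩
  have hx := memLp_two_of_lipschitz hG hlip hxs x
  have i1 : Integrable (fun s => ‖G x s‖ ^ 2) ν := hx.integrable_norm_pow two_ne_zero
  have i2 : Integrable (G x) ν := hx.integrable one_le_two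
  have i3 : Integrable (fun s => inner ℝ (gradient V (x - xs)) (G x s)) ν := i2.const_inner _
  set y := x - xs with hy
  let B : Ξ → ℝ := fun s => V y + -η * inner ℝ (gradient V y) (G x s)
    + LV * η ^ 2 * ‖G x s‖ ^ 2
  have iB' : Integrable (fun s => V y + -η * inner ℝ (gradient V y) (G x s)) ν :=
    (integrable_const _).add (i3.const_mul _)
  have iB : Integrable B ν := iB'.add (i1.const_mul _)
  have hB : ∀ s, V (x - η • G x s - xs) ≤ B s := fun s => by
    have := le_of_lipschitz_gradient hV hLV hVlip y (-(η • G x s))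
    rw [inner_neg_right, inner_smul_right, norm_neg, norm_smul, Real.norm_eq_abs, mul_pow,
      sq_abs] at this
    have e : x - η • G x s - xs = y + -(η • G x s) := by rw [hy]; abel
    rw [e]
    refine this.trans (le_of_eq ?_)
    simp only [B]
    ring
  have hintB : ∫ s, B s ∂ν = V y - η * inner ℝ (gradient V y) (meanField ν G x)
      + LV * η ^ 2 * ∫ s, ‖G x s‖ ^ 2 ∂ν := by
    simp only [B]
    rw [integral_add iB' (i1.const_mul _), integral_add (integrable_const _) (i3.const_mul _),
      integral_const_mul, integral_const_mul, integral_inner i2, integral_const]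
    simp [meanField]
    ring
  have h1 : ∫⁻ s, ENNReal.ofReal (V (x - η • G x s - xs)) ∂ν ≤ ENNReal.ofReal (∫ s, B s ∂ν) := by
    rw [ofReal_integral_eq_lintegral_ofReal iB
      (Eventually.of_forall fun s => (hVnn _).trans (hB s))]
    exact lintegral_mono fun s => ENNReal.ofReal_le_ofReal (hB s)
  have hB0 : 0 ≤ ∫ s, B s ∂ν := integral_nonneg fun s => (hVnn _).trans (hB s)
  refine (add_le_add_left h1 _).trans ?_
  rw [← ENNReal.ofReal_add hB0 (mul_nonneg hη (hpos x))]
  refine ENNReal.ofReal_le_ofReal ?_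
  rw [hintB]
  have h2 := integral_norm_sq_le hG hL hlip hxs x
  have h3 : ‖y‖ ^ 2 ≤ V y / μV := by
    rw [le_div_iff₀ hμV]
    linarith [hVlow y]
  have h4 : ∫ s, ‖G x s‖ ^ 2 ∂ν ≤ 2 * L ^ 2 * (V y / μV) + 2 * m := by
    refine h2.trans ?_
    rw [mul_pow]
    nlinarith [sq_nonneg L]
  have h5 : 2 * L ^ 2 * (V y / μV) + 2 * m ≤ (2 * L ^ 2 / μV + 2 * m) * (V y + 1) := by
    have : 0 ≤ 2 * m * V y + 2 * L ^ 2 / μV := by have := hVnn y; positivity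
    have e : 2 * L ^ 2 * (V y / μV) = 2 * L ^ 2 / μV * V y := by ring
    rw [e]; nlinarith
  have h6 := mul_le_mul_of_nonneg_left (h4.trans h5) (by positivity : 0 ≤ LV * η ^ 2)
  linarith

end MeanSquare

/-! ### Robbins–Siegmund and almost sure convergence of the recursion. -/

theorem exists_tendsto_prod_one_add {b : ℕ → ℝ} (hb0 : ∀ t, 0 ≤ b t) (hb : Summable b) :
    ∃ P, Tendsto (fun t => ∏ i ∈ Finset.range t, (1 + b i)) atTop (𝓝 P) := by
  -- The products increase and are bounded by the exponential of the sum, as `1 + b ≤ exp b`.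
  refine ⟨_, tendsto_atTop_ciSup (monotone_nat_of_le_succ fun t => ?_)
    ⟨Real.exp (∑' i, b i), ?_⟩⟩
  · rw [Finset.prod_range_succ]
    have : 0 ≤ ∏ i ∈ Finset.range t, (1 + b i) :=
      Finset.prod_nonneg fun i _ => by linarith [hb0 i]
    nlinarith [hb0 t]
  · rintro _ ⟨t, rfl⟩
    calc ∏ i ∈ Finset.range t, (1 + b i) ≤ ∏ i ∈ Finset.range t, Real.exp (b i) :=
          Finset.prod_le_prod (fun i _ => by linarith [hb0 i])
            fun i _ => by linarith [Real.add_one_le_exp (b i)]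
      _ = Real.exp (∑ i ∈ Finset.range t, b i) := (Real.exp_sum _ _).symm
      _ ≤ _ := Real.exp_le_exp.2 (hb.sum_le_tsum _ fun i _ => hb0 i)

/-- Almost supermartingale convergence (Robbins–Siegmund). -/
theorem ae_tendsto_and_summable_of_almost_supermartingale
    {μ : Measure Ω} [IsFiniteMeasure μ] {ℱ : Filtration ℕ ‹MeasurableSpace Ω›} {v u : ℕ → Ω → ℝ} {b : ℕ → ℝ}
    (hb0 : ∀ t, 0 ≤ b t) (hb : Summable b) (hv0 : ∀ t ω, 0 ≤ v t ω) (hu0 : ∀ t ω, 0 ≤ u t ω)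
    (hv : ∀ t, Measurable[ℱ t] (v t)) (hu : ∀ t, Measurable[ℱ t] (u t))
    (hint : Integrable (v 0) μ)
    (hstep : ∀ t A, MeasurableSet[ℱ t] A →
      ∫⁻ ω in A, ENNReal.ofReal (v (t + 1) ω) ∂μ + ∫⁻ ω in A, ENNReal.ofReal (u t ω) ∂μ
        ≤ ∫⁻ ω in A, ENNReal.ofReal ((1 + b t) * v t ω + b t) ∂μ) :
    ∀ᵐ ω ∂μ, (∃ c, Tendsto (fun t => v t ω) atTop (𝓝 c)) ∧ Summable fun t => u t ω := by
  have hvm : ∀ t, Measurable (v t) := fun t => (hv t).mono (ℱ.le t) le_rfl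
  have hum : ∀ t, Measurable (u t) := fun t => (hu t).mono (ℱ.le t) le_rfl
  have ofFin : ∀ f : Ω → ℝ, Measurable f → (∀ ω, 0 ≤ f ω) →
      ∫⁻ ω, ENNReal.ofReal (f ω) ∂μ < ⊤ → Integrable f μ := fun f hf h0 hlt =>
    ⟨hf.aestronglyMeasurable, by
      rwa [hasFiniteIntegral_iff_ofReal (Eventually.of_forall h0)]⟩
  have hbd : ∀ t, Integrable (v t) μ → Integrable (fun ω => (1 + b t) * v t ω + b t) μ :=
    fun t h => (h.const_mul _).add (integrable_const _)
  have hrhs : ∀ t, Integrable (v t) μ →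
      ∫⁻ ω, ENNReal.ofReal ((1 + b t) * v t ω + b t) ∂μ < ⊤ := fun t h =>
    (hasFiniteIntegral_iff_ofReal (Eventually.of_forall fun ω => by
      have := hb0 t; have := hv0 t ω; positivity)).1 (hbd t h).2
  have hstep' : ∀ t, ∫⁻ ω, ENNReal.ofReal (v (t + 1) ω) ∂μ + ∫⁻ ω, ENNReal.ofReal (u t ω) ∂μ
        ≤ ∫⁻ ω, ENNReal.ofReal ((1 + b t) * v t ω + b t) ∂μ := fun t => by
    simpa using hstep t Set.univ MeasurableSet.univ
  have iv : ∀ t, Integrable (v t) μ := fun t => by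
    induction t with
    | zero => exact hint
    | succ t ih =>
      exact ofFin _ (hvm _) (hv0 _) ((le_self_add.trans (hstep' t)).trans_lt (hrhs t ih))
  have iu : ∀ t, Integrable (u t) μ := fun t =>
    ofFin _ (hum _) (hu0 _) ((le_add_self.trans (hstep' t)).trans_lt (hrhs t (iv t)))
  have hreal : ∀ t A, MeasurableSet[ℱ t] A → ∫ ω in A, v (t + 1) ω ∂μ + ∫ ω in A, u t ω ∂μ
      ≤ (1 + b t) * ∫ ω in A, v t ω ∂μ + b t * μ.real A := fun t A hA => by
    have h1 := hstep t A hA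
    have hnn : ∀ ω, 0 ≤ (1 + b t) * v t ω + b t := fun ω => by
      have := hb0 t; have := hv0 t ω; positivity
    rw [← ofReal_integral_eq_lintegral_ofReal (iv _).integrableOn
        (Eventually.of_forall (hv0 _)),
      ← ofReal_integral_eq_lintegral_ofReal (iu _).integrableOn (Eventually.of_forall (hu0 _)),
      ← ofReal_integral_eq_lintegral_ofReal (hbd t (iv t)).integrableOn
        (Eventually.of_forall hnn),
      ← ENNReal.ofReal_add (integral_nonneg (hv0 _)) (integral_nonneg (hu0 _)),
      ENNReal.ofReal_le_ofReal_iff (integral_nonneg hnn)] at h1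
    rw [integral_add ((iv t).const_mul _).integrableOn (integrable_const _),
      integral_const_mul, integral_const] at h1
    simpa [mul_comm (b t)] using h1
  obtain ⟨P', hP'⟩ := exists_tendsto_prod_one_add hb0 hb
  set P : ℕ → ℝ := fun t => ∏ i ∈ Finset.range t, (1 + b i) with hP
  have hPs : ∀ t, P (t + 1) = P t * (1 + b t) := fun t => Finset.prod_range_succ _ _
  have hP1 : ∀ t, 1 ≤ P t := fun t => by
    induction t with
    | zero => simp [hP]
    | succ t ih => rw [hPs]; nlinarith [hb0 t]
  have hP0 : ∀ t, 0 < P t := fun t => one_pos.trans_le (hP1 t)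
  let U : ℕ → Ω → ℝ := fun t ω => ∑ i ∈ Finset.range t, u i ω / P (i + 1)
  let s : ℕ → ℝ := fun t => ∑ i ∈ Finset.range t, b i
  -- Dividing by `P` removes the factors `1 + b t`, `U` restores the decrements and `s` removes the
  -- additive errors. The result is a supermartingale bounded below by `-∑ b`.
  let N : ℕ → Ω → ℝ := fun t ω => v t ω / P t + U t ω - s t
  have iU : ∀ t, Integrable (U t) μ := fun t =>
    integrable_finsetSum _ fun i _ => (iu i).div_const _
  have iN : ∀ t, Integrable (N t) μ := fun t =>
    (((iv t).div_const _).add (iU t)).sub (integrable_const _)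
  have hN : Supermartingale N ℱ μ := by
    refine supermartingale_of_setIntegral_succ_le (fun t => ?_) iN fun t A hA => ?_
    · refine Measurable.stronglyMeasurable (Measurable.sub_const (((hv t).div_const _).add ?_) _)
      exact Finset.measurable_fun_sum _ fun i hi =>
        ((hu i).mono (ℱ.mono (Finset.mem_range.1 hi).le) le_rfl).div_const _
    · have hdiff : ∀ ω, N (t + 1) ω - N t ω
          = v (t + 1) ω / P (t + 1) + u t ω / P (t + 1) - v t ω / P t - b t := fun ω => by
        simp only [N, U, s, Finset.sum_range_succ]; ring
      rw [← sub_nonpos, ← integral_sub (iN _).integrableOn (iN _).integrableOn]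
      simp only [hdiff]
      have i1 := (((iv (t + 1)).div_const (P (t + 1))).integrableOn (s := A))
      have i2 := (((iu t).div_const (P (t + 1))).integrableOn (s := A))
      have i3 := (((iv t).div_const (P t)).integrableOn (s := A))
      rw [integral_sub (by exact (i1.add i2).sub i3) (integrable_const _),
        integral_sub (by exact i1.add i2) i3, integral_add i1 i2,
        integral_div, integral_div, integral_div, integral_const, ← add_div]
      have h1 := hreal t A hA
      simp only [measureReal_restrict_apply_univ, smul_eq_mul]
      have h2 : (∫ ω in A, v (t + 1) ω ∂μ + ∫ ω in A, u t ω ∂μ) / P (t + 1)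
          ≤ (∫ ω in A, v t ω ∂μ) / P t + μ.real A * b t := by
        rw [div_le_iff₀ (hP0 _), hPs]
        have e : ((∫ ω in A, v t ω ∂μ) / P t + μ.real A * b t) * (P t * (1 + b t))
            = (1 + b t) * (∫ ω in A, v t ω ∂μ) + μ.real A * b t * (P t * (1 + b t)) := by
          have := (hP0 t).ne'
          field_simp
        rw [e]
        have h3 : 1 ≤ P t * (1 + b t) := hPs t ▸ hP1 _
        have h4 : 0 ≤ μ.real A * b t := mul_nonneg measureReal_nonneg (hb0 t)
        nlinarith
      linarith
  have hU0 : ∀ t ω, 0 ≤ U t ω := fun t ω =>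
    Finset.sum_nonneg fun i _ => div_nonneg (hu0 _ _) (hP0 _).le
  have hs : ∀ t, s t ≤ ∑' i, b i := fun t => hb.sum_le_tsum _ fun i _ => hb0 i
  have hs0 : ∀ t, 0 ≤ s t := fun t => Finset.sum_nonneg fun i _ => hb0 i
  have hEN : ∀ t, ∫ ω, N t ω ∂μ ≤ ∫ ω, v 0 ω ∂μ := fun t => by
    have := hN.setIntegral_le t.zero_le MeasurableSet.univ
    simpa [N, U, s, hP] using this
  have hbdd : ∀ t, eLpNorm ((-N) t) 1 μ
      ≤ (∫ ω, v 0 ω ∂μ + 2 * (∑' i, b i) * μ.real Set.univ).toNNReal := fun t => by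
    rw [eLpNorm_one_eq_lintegral_enorm, ← ofReal_integral_norm_eq_lintegral_enorm (by exact (iN t).neg)]
    refine ENNReal.ofReal_le_ofReal ?_
    -- Since `N ≥ -∑ b`, one has `|N| ≤ N + 2 ∑ b`, and the mean of `N` does not increase.
    calc ∫ ω, ‖(-N) t ω‖ ∂μ ≤ ∫ ω, (N t ω + 2 * ∑' i, b i) ∂μ := by
          refine integral_mono (iN t).neg.norm ((iN t).add (integrable_const _)) fun ω => ?_
          simp only [Pi.neg_apply, norm_neg, Real.norm_eq_abs, N]
          have h1 := div_nonneg (hv0 t ω) (hP0 t).le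
          rw [abs_le]
          constructor <;> linarith [hU0 t ω, hs t, hs0 t]
      _ ≤ _ := by
          rw [integral_add (iN t) (integrable_const _), integral_const]
          simp only [smul_eq_mul]
          linarith [hEN t]
  filter_upwards [hN.neg.exists_ae_tendsto_of_bdd hbdd] with ω hω
  obtain ⟨c, hc⟩ := hω
  have hNc : Tendsto (fun t => N t ω) atTop (𝓝 (-c)) := by simpa using hc.neg
  obtain ⟨B, hB⟩ := hNc.bddAbove_range
  have hsumU : Summable fun i => u i ω / P (i + 1) := by
    refine summable_of_sum_range_le (c := B + ∑' i, b i)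
      (fun i => div_nonneg (hu0 _ _) (hP0 _).le) fun t => ?_
    have h1 : N t ω ≤ B := hB ⟨t, rfl⟩
    have h2 := div_nonneg (hv0 t ω) (hP0 t).le
    simp only [N, U] at h1
    linarith [hs t]
  constructor
  · have h1 : Tendsto (fun t => (N t ω - U t ω + s t) * P t) atTop
        (𝓝 ((-c - ∑' i, u i ω / P (i + 1) + ∑' i, b i) * P')) :=
      ((hNc.sub hsumU.hasSum.tendsto_sum_nat).add hb.hasSum.tendsto_sum_nat).mul hP'
    refine ⟨_, h1.congr fun t => ?_⟩
    have := (hP0 t).ne'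
    simp only [N]
    field_simp
    ring
  · obtain ⟨B', hB'⟩ := hP'.bddAbove_range
    refine Summable.of_nonneg_of_le (fun i => hu0 i ω) (fun i => ?_) (hsumU.mul_left B')
    have h1 : P (i + 1) ≤ B' := hB' ⟨i + 1, rfl⟩
    rw [mul_div_assoc', le_div_iff₀ (hP0 _), mul_comm]
    exact mul_le_mul_of_nonneg_right h1 (hu0 i ω)

/-- A sequence along which a Lyapunov function converges and its decrements are summable
against step sizes of infinite sum tends to the zero of the Lyapunov function. -/
theorem tendsto_zero_of_lyapunov {E : Type*} [NormedAddCommGroup E] [ProperSpace E]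
    {V u : E → ℝ} (hV : Continuous V) (hu : Continuous u) (hV0 : V 0 = 0) {μV : ℝ}
    (hμV : 0 < μV) (hVlow : ∀ y, μV * ‖y‖ ^ 2 ≤ V y) (hpos : ∀ y, y ≠ 0 → 0 < u y)
    {η : ℕ → ℝ} (hη : ∀ t, 0 ≤ η t) (hsum : ¬ Summable η) {y : ℕ → E} {c : ℝ}
    (hc : Tendsto (fun t => V (y t)) atTop (𝓝 c)) (hs : Summable fun t => η t * u (y t)) :
    Tendsto y atTop (𝓝 0) := by
  have hVnn : ∀ y, 0 ≤ V y := fun y => (by positivity : 0 ≤ μV * ‖y‖ ^ 2).trans (hVlow y)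
  have hc0 : 0 ≤ c := ge_of_tendsto' hc fun t => hVnn _
  obtain rfl | hcpos := hc0.eq_or_lt
  · have h1 : Tendsto (fun t => ‖y t‖ ^ 2) atTop (𝓝 0) := by
      refine squeeze_zero (fun t => by positivity) (fun t => ?_)
        (by simpa using hc.div_const μV : Tendsto (fun t => V (y t) / μV) atTop (𝓝 0))
      rw [le_div_iff₀ hμV]
      linarith [hVlow (y t)]
    rw [tendsto_zero_iff_norm_tendsto_zero]
    simpa [Function.comp_def] using (Real.continuous_sqrt.tendsto 0).comp h1
  -- If `c > 0`, the sequence ends up in a compact shell avoiding `0`. There `u` has a positive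
  -- minimum, so summability of `η t * u (y t)` would force that of `η`.
  · exfalso
    let K : Set E := {z | V z ≤ 2 * c} ∩ {z | c / 2 ≤ V z}
    have hKc : IsClosed K :=
      (isClosed_le hV continuous_const).inter (isClosed_le continuous_const hV)
    have hKb : K ⊆ Metric.closedBall 0 (Real.sqrt (2 * c / μV)) := fun z hz => by
      rw [mem_closedBall_zero_iff]
      refine Real.le_sqrt_of_sq_le ?_
      rw [le_div_iff₀ hμV]
      have := hz.1
      simp only [Set.mem_ofPred_eq] at this
      linarith [hVlow z]
    have hK : IsCompact K := (isCompact_closedBall _ _).of_isClosed_subset hKc hKb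
    have hev : ∀ᶠ t in atTop, y t ∈ K := by
      filter_upwards [hc.eventually_le_const (by linarith : c < 2 * c),
        hc.eventually_const_le (by linarith : c / 2 < c)] with t h1 h2 using ⟨h1, h2⟩
    obtain ⟨t0, ht0⟩ := hev.exists
    obtain ⟨z, hz, hmin⟩ := hK.exists_isMinOn ⟨_, ht0⟩ hu.continuousOn
    have hz0 : z ≠ 0 := by
      rintro rfl
      have := hz.2
      simp only [Set.mem_ofPred_eq, hV0] at this
      linarith
    have hm := hpos z hz0
    refine hsum ?_
    rw [← summable_mul_right_iff hm.ne']
    refine Summable.of_norm_bounded_eventually_nat hs ?_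
    filter_upwards [hev] with t ht
    rw [Real.norm_of_nonneg (mul_nonneg (hη t) hm.le)]
    exact mul_le_mul_of_nonneg_left (hmin ht) (hη t)

/-- `V` is minimal at `0`, so its gradient vanishes there and the descent lemma leaves only the
quadratic term. -/
theorem le_mul_norm_sq_of_lipschitz_gradient {V : Vec d → ℝ} (hV : Differentiable ℝ V)
    (hV0 : V 0 = 0) (hVnn : ∀ y, 0 ≤ V y) {LV : ℝ} (hLV : 0 ≤ LV)
    (hVlip : ∀ y z, ‖gradient V y - gradient V z‖ ≤ LV * ‖y - z‖) (y : Vec d) :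
    V y ≤ LV * ‖y‖ ^ 2 := by
  have := le_of_lipschitz_gradient hV hLV hVlip 0 y
  rwa [gradient_eq_zero_of_isMinOn fun z => hV0 ▸ hVnn z, inner_zero_left, zero_add, hV0,
    zero_add, zero_add] at this

theorem continuous_of_norm_sub_le {E F : Type*} [NormedAddCommGroup E] [NormedAddCommGroup F]
    {f : E → F} {L : ℝ} (hL : 0 ≤ L) (h : ∀ y z, ‖f y - f z‖ ≤ L * ‖y - z‖) : Continuous f :=
  (LipschitzWith.of_dist_le_mul (K := ⟨L, hL⟩) fun y z => by
    rw [dist_eq_norm, dist_eq_norm]; exact h y z).continuous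

section Recursion

variable {μ : Measure Ω} [IsProbabilityMeasure μ] {ν : Measure Ξ} [IsProbabilityMeasure ν]
  {x₀ : Ω → Vec d} {ξ : ℕ → Ω → Ξ} {G : Vec d → Ξ → Vec d} {η : ℕ → ℝ}

/-- A one-step bound for a deterministic starting point holds along the recursion on every
event of the past. -/
theorem IsDataStream.lintegral_iter_succ (hdata : IsDataStream μ ν x₀ ξ)
    (hG : Measurable (Function.uncurry G)) (t : ℕ) {v w r : Vec d → ENNReal}
    (hv : Measurable v) (hw : Measurable w)
    (h : ∀ x, ∫⁻ s, v (x - η t • G x s) ∂ν + w x ≤ r x) {A : Set Ω}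
    (hA : MeasurableSet[history x₀ ξ t] A) :
    ∫⁻ ω in A, v (iter G η x₀ ξ (t + 1) ω) ∂μ + ∫⁻ ω in A, w (iter G η x₀ ξ t ω) ∂μ
      ≤ ∫⁻ ω in A, r (iter G η x₀ ξ t ω) ∂μ := by
  have hX := measurable_iter hG η x₀ ξ t
  have h1 : ∫⁻ ω in A, v (iter G η x₀ ξ (t + 1) ω) ∂μ
      = ∫⁻ ω in A, ∫⁻ s, v (iter G η x₀ ξ t ω - η t • G (iter G η x₀ ξ t ω) s) ∂ν ∂μ :=
    hdata.lintegral_data t hX (f := fun x s => v (x - η t • G x s))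
      (hv.comp (measurable_fst.sub (hG.const_smul (η t)))) hA
  rw [h1, ← lintegral_add_right _ (by exact hw.comp (hX.mono (hdata.history_le t) le_rfl))]
  exact lintegral_mono fun ω => h _

/-- Robbins–Siegmund applies to `V (x t - xs)`, with the inner products of the drift as decrements;
`tendsto_zero_of_lyapunov` then identifies the limit path by path. -/
theorem IsDataStream.ae_tendsto_iter (hdata : IsDataStream μ ν x₀ ξ)
    (hG : Measurable (Function.uncurry G)) {xs : Vec d} (hroot : meanField ν G xs = 0)
    {L : ℝ} (hL : 0 ≤ L)
    (hlip : ∀ x y, eLpNorm (fun s => G x s - G y s) 2 ν ≤ ENNReal.ofReal (L * ‖x - y‖))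
    (hxs : MemLp (G xs) 2 ν) {V : Vec d → ℝ} (hV : Differentiable ℝ V) (hV0 : V 0 = 0)
    {μV LV : ℝ} (hμV : 0 < μV) (hVlow : ∀ y, μV * ‖y‖ ^ 2 ≤ V y) (hLV : 0 ≤ LV)
    (hVlip : ∀ y z, ‖gradient V y - gradient V z‖ ≤ LV * ‖y - z‖)
    (hpos : ∀ x, x ≠ xs → 0 < inner ℝ (gradient V (x - xs)) (meanField ν G x))
    (hη : ∀ t, 0 ≤ η t) (hsum : ¬ Summable η) (hsq : Summable fun t => η t ^ 2) :
    ∀ᵐ ω ∂μ, Tendsto (fun t => iter G η x₀ ξ t ω) atTop (𝓝 xs) := by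
  have hVnn : ∀ y, 0 ≤ V y := fun y => (by positivity : 0 ≤ μV * ‖y‖ ^ 2).trans (hVlow y)
  have hpos' : ∀ x, 0 ≤ inner ℝ (gradient V (x - xs)) (meanField ν G x) := fun x => by
    by_cases hx : x = xs
    · simp [hx, hroot]
    · exact (hpos x hx).le
  obtain ⟨C, hC0, hC⟩ := exists_lyapunov_step hG hL hlip hxs hV hμV hVlow hLV hVlip hpos'
  let u : Vec d → ℝ := fun x => inner ℝ (gradient V (x - xs)) (meanField ν G x)
  have hgc : Continuous (meanField ν G) :=
    continuous_of_norm_sub_le hL (norm_meanField_sub_le hG hL hlip hxs)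
  have hu : Continuous u :=
    ((continuous_of_norm_sub_le hLV hVlip).comp (continuous_id.sub continuous_const)).inner hgc
  have hVc : Continuous fun x => V (x - xs) := hV.continuous.comp (by fun_prop)
  -- The initial point need not have any moment. On these events of the past, which exhaust `Ω`, `V
  -- (x₀ - xs)` is bounded.
  let B : ℕ → Set Ω := fun N => {ω | ‖x₀ ω - xs‖ ≤ N}
  have hB : ∀ N t, MeasurableSet[history x₀ ξ t] (B N) := fun N t =>
    measurable_init_history x₀ ξ t (isClosed_le (f := fun x : Vec d => ‖x - xs‖)
      (g := fun _ => (N : ℝ)) (by fun_prop) continuous_const).measurableSet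
  have key : ∀ N, ∀ᵐ ω ∂μ.restrict (B N),
      Tendsto (fun t => iter G η x₀ ξ t ω) atTop (𝓝 xs) := fun N => by
    have hBm : MeasurableSet (B N) := hdata.history_le 0 _ (hB N 0)
    have hRS := ae_tendsto_and_summable_of_almost_supermartingale (μ := μ.restrict (B N))
      (ℱ := hdata.filtration) (v := fun t ω => V (iter G η x₀ ξ t ω - xs))
      (u := fun t ω => η t * u (iter G η x₀ ξ t ω)) (b := fun t => C * η t ^ 2)
      (fun t => by positivity) (hsq.mul_left C) (fun t ω => hVnn _)
      (fun t ω => mul_nonneg (hη t) (hpos' _))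
      (fun t => hVc.measurable.comp (measurable_iter hG η x₀ ξ t))
      (fun t => (hu.measurable.comp (measurable_iter hG η x₀ ξ t)).const_mul _)
      (Integrable.of_bound (C := LV * (N : ℝ) ^ 2)
        (hVc.measurable.comp hdata.measurable_init).aestronglyMeasurable
        ((ae_restrict_iff' hBm).2 (Eventually.of_forall fun ω hω => by
          rw [Real.norm_of_nonneg (hVnn _)]
          refine (le_mul_norm_sq_of_lipschitz_gradient hV hV0 hVnn hLV hVlip _).trans ?_
          have : ‖x₀ ω - xs‖ ≤ N := hω
          simp only [iter]
          gcongr)))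
      (fun t A hA => by
        rw [Measure.restrict_restrict (hdata.history_le t A hA)]
        exact hdata.lintegral_iter_succ hG t (v := fun x => ENNReal.ofReal (V (x - xs)))
          (w := fun x => ENNReal.ofReal (η t * u x))
          (r := fun x => ENNReal.ofReal ((1 + C * η t ^ 2) * V (x - xs) + C * η t ^ 2))
          hVc.measurable.ennreal_ofReal (hu.measurable.const_mul _).ennreal_ofReal
          (hC (η t) (hη t)) (MeasurableSet.inter hA (hB N t)))
    filter_upwards [hRS] with ω ⟨⟨c, hc⟩, hs⟩
    have := tendsto_zero_of_lyapunov (u := fun y => u (y + xs)) (y := fun t =>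
      iter G η x₀ ξ t ω - xs) hV.continuous (hu.comp (by fun_prop)) hV0 hμV hVlow
      (fun y hy => hpos _ (by simpa using hy)) hη hsum hc (by simpa using hs)
    simpa using this.add_const xs
  have hall : ∀ᵐ ω ∂μ, ∀ N : ℕ, ω ∈ B N →
      Tendsto (fun t => iter G η x₀ ξ t ω) atTop (𝓝 xs) :=
    ae_all_iff.2 fun N => (ae_restrict_iff' (hdata.history_le 0 _ (hB N 0))).1 (key N)
  filter_upwards [hall] with ω hω
  obtain ⟨N, hN⟩ := exists_nat_ge ‖x₀ ω - xs‖
  exact hω N hN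

end Recursion

/-! ### Step sizes, deterministic recursions and a logarithmic series. -/

theorem stepSize_pos {η₀ a : ℝ} (h : 0 < η₀) (t : ℕ) : 0 < stepSize η₀ a t := by
  unfold stepSize
  split_ifs with ht
  · exact h
  · have : (0 : ℝ) < t := by exact_mod_cast Nat.pos_of_ne_zero ht
    positivity

theorem stepSize_of_ne_zero (η₀ a : ℝ) {t : ℕ} (ht : t ≠ 0) :
    stepSize η₀ a t = η₀ * (t : ℝ) ^ (-a) := if_neg ht

theorem not_summable_stepSize {η₀ a : ℝ} (h : 0 < η₀) (ha : a < 1) :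
    ¬ Summable (stepSize η₀ a) := by
  intro hs
  have h1 : Summable fun t : ℕ => η₀ * (t : ℝ) ^ (-a) :=
    (summable_congr_atTop (eventually_atTop.2 ⟨1, fun t ht =>
      stepSize_of_ne_zero η₀ a (by omega)⟩)).1 hs
  rw [summable_mul_left_iff h.ne', Real.summable_nat_rpow] at h1
  linarith

theorem summable_stepSize_sq {η₀ a : ℝ} (ha : 1 / 2 < a) :
    Summable fun t => stepSize η₀ a t ^ 2 := by
  have h1 : Summable fun t : ℕ => η₀ ^ 2 * (t : ℝ) ^ (-(2 * a)) :=
    (Real.summable_nat_rpow.2 (by linarith)).mul_left _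
  refine (summable_congr_atTop (eventually_atTop.2 ⟨1, fun t ht => ?_⟩)).2 h1
  rw [stepSize_of_ne_zero η₀ a (by omega), mul_pow, ← Real.rpow_natCast ((t : ℝ) ^ (-a)),
    ← Real.rpow_mul (Nat.cast_nonneg t)]
  congr 2
  push_cast
  ring

theorem tendsto_stepSize {η₀ a : ℝ} (ha : 0 < a) :
    Tendsto (stepSize η₀ a) atTop (𝓝 0) := by
  have h1 : Tendsto (fun t : ℕ => η₀ * (t : ℝ) ^ (-a)) atTop (𝓝 0) := by
    simpa using ((tendsto_rpow_neg_atTop ha).comp tendsto_natCast_atTop_atTop).const_mul η₀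
  exact h1.congr' (eventually_atTop.2 ⟨1, fun t ht =>
    (stepSize_of_ne_zero η₀ a (by omega)).symm⟩)

/-- The ratio `t / (t + 1)` is at most one, so raising it to a power `a < 1` does not decrease it.
-/
theorem stepSize_succ_ge {η₀ a : ℝ} (h : 0 < η₀) (ha0 : 0 < a) (ha : a < 1) {t : ℕ}
    (ht : t ≠ 0) :
    stepSize η₀ a t * (1 - 1 / (t + 1)) ≤ stepSize η₀ a (t + 1) := by
  have ht' : (0 : ℝ) < t := by exact_mod_cast Nat.pos_of_ne_zero ht
  rw [stepSize_of_ne_zero η₀ a ht, stepSize_of_ne_zero η₀ a t.succ_ne_zero, mul_assoc]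
  refine mul_le_mul_of_nonneg_left ?_ h.le
  have h1 : (1 : ℝ) - 1 / (t + 1) = t / (t + 1) := by field_simp; ring
  have h2 : ((t : ℝ) / (t + 1)) ^ (1 : ℝ) ≤ ((t : ℝ) / (t + 1)) ^ a :=
    Real.rpow_le_rpow_of_exponent_ge (by positivity)
      ((div_le_one (by positivity)).2 (by linarith)) ha.le
  rw [Real.rpow_one, Real.div_rpow ht'.le (by positivity)] at h2
  rw [h1]
  push_cast
  rw [Real.rpow_neg ht'.le, Real.rpow_neg (by positivity)]
  calc ((t : ℝ) ^ a)⁻¹ * (t / (t + 1)) ≤ ((t : ℝ) ^ a)⁻¹ * ((t : ℝ) ^ a / ((t : ℝ) + 1) ^ a) := by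
        gcongr
    _ = (((t : ℝ) + 1) ^ a)⁻¹ := by
        have : (t : ℝ) ^ a ≠ 0 := by positivity
        field_simp

/-- Because `t^{1-a} → ∞`, the relative decay of the step sizes is negligible against a contraction
at rate `l * η_t`. -/
theorem eventually_inv_succ_le_stepSize {η₀ a l : ℝ} (h : 0 < η₀) (ha : a < 1) (hl : 0 < l) :
    ∀ᶠ t : ℕ in atTop, 1 / ((t : ℝ) + 1) ≤ l * stepSize η₀ a t := by
  have h1 : Tendsto (fun t : ℕ => (t : ℝ) ^ (1 - a)) atTop atTop :=
    (tendsto_rpow_atTop (by linarith)).comp tendsto_natCast_atTop_atTop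
  filter_upwards [h1.eventually_ge_atTop (1 / (l * η₀)), eventually_ge_atTop 1] with t ht ht1
  have ht' : (0 : ℝ) < t := by exact_mod_cast ht1
  rw [stepSize_of_ne_zero η₀ a (by omega), div_le_iff₀ (by positivity)]
  rw [div_le_iff₀ (by positivity), sub_eq_add_neg, Real.rpow_add ht', Real.rpow_one] at ht
  have : 0 ≤ l * (η₀ * (t : ℝ) ^ (-a)) := by positivity
  nlinarith

/-- A nonnegative sequence contracting at the rate of the step sizes, up to an error of the order
of their squares, is of the order of the step sizes. -/
theorem exists_le_mul_stepSize {η₀ a l C : ℝ} (h : 0 < η₀) (ha0 : 0 < a) (ha : a < 1)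
    (hl : 0 < l) {c : ℕ → ℝ} (hc0 : ∀ t, 0 ≤ c t) {s : ℕ}
    (hc : ∀ t, s ≤ t → c (t + 1) + l * stepSize η₀ a t * c t
      ≤ (1 + C * stepSize η₀ a t ^ 2) * c t + C * stepSize η₀ a t ^ 2) :
    ∃ M T, 0 ≤ M ∧ ∀ t, T ≤ t → c t ≤ M * stepSize η₀ a t := by
  have ev1 : ∀ᶠ t in atTop, C * stepSize η₀ a t < l / 2 := by
    have := (tendsto_stepSize (η₀ := η₀) ha0).const_mul C
    rw [mul_zero] at this
    exact this.eventually_lt_const (by linarith)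
  have ev2 : ∀ᶠ t in atTop, l * stepSize η₀ a t < 1 := by
    have := (tendsto_stepSize (η₀ := η₀) ha0).const_mul l
    rw [mul_zero] at this
    exact this.eventually_lt_const one_pos
  obtain ⟨T, hT⟩ := eventually_atTop.1 (ev1.and (ev2.and
    ((eventually_inv_succ_le_stepSize h ha (by linarith : 0 < l / 4)).and
      ((eventually_ge_atTop s).and (eventually_ge_atTop 1)))))
  have hp := stepSize_pos (a := a) h
  -- The second entry starts the induction at `T`. The first makes the additive error at most `M l
  -- η² / 4`: of the net contraction `l η / 2`, one half absorbs it and the other half covers the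
  -- decay of the step size.
  set M := max (4 * C / l) (c T / stepSize η₀ a T)
  have hM0 : 0 ≤ M := (div_nonneg (hc0 T) (hp T).le).trans (le_max_right _ _)
  have hMC : C ≤ M * l / 4 := by
    have : 4 * C / l ≤ M := le_max_left _ _
    rw [div_le_iff₀ hl] at this
    linarith
  refine ⟨M, T, hM0, fun t ht => ?_⟩
  induction t, ht using Nat.le_induction with
  | base => exact (div_le_iff₀ (hp T)).1 (le_max_right _ _)
  | succ t ht ih =>
    obtain ⟨h1, h2, h3, h4, h5⟩ := hT t ht
    have h6 := stepSize_succ_ge h ha0 ha (t := t) (by omega)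
    have h7 := hc t h4
    have hpt := hp t
    generalize stepSize η₀ a (t + 1) = e' at *
    generalize stepSize η₀ a t = e at *
    have h8 : c (t + 1) ≤ (1 - l * e / 2) * c t + C * e ^ 2 := by
      have := mul_le_mul_of_nonneg_right h1.le (mul_nonneg hpt.le (hc0 t))
      nlinarith
    have h9 : (1 - l * e / 2) * c t ≤ (1 - l * e / 2) * (M * e) :=
      mul_le_mul_of_nonneg_left ih (by linarith)
    have h10 : C * e ^ 2 ≤ M * l / 4 * e ^ 2 := by gcongr
    have h11 : e * (1 - l / 4 * e) ≤ e' :=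
      (mul_le_mul_of_nonneg_left (by linarith) hpt.le).trans h6
    have h12 := mul_le_mul_of_nonneg_left h11 hM0
    nlinarith

theorem log_add_two_pos (t : ℕ) : 0 < Real.log ((t : ℝ) + 2) :=
  Real.log_pos (by linarith [(Nat.cast_nonneg t : (0 : ℝ) ≤ t)])

/-- Cauchy condensation compares it with `∑ 1 / k²`. The weights and normalizations below are chosen
so that this borderline series appears, which is the source of their logarithms. -/
theorem summable_inv_mul_log_sq :
    Summable fun t : ℕ => 1 / (((t : ℝ) + 1) * Real.log ((t : ℝ) + 2) ^ 2) := by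
  rw [← summable_condensed_iff_of_nonneg]
  · have h1 : Summable fun k : ℕ => (1 / Real.log 2 ^ 2) * (1 / (k : ℝ) ^ 2) :=
      (Real.summable_one_div_nat_pow.2 one_lt_two).mul_left _
    refine Summable.of_norm_bounded_eventually_nat h1 ?_
    filter_upwards [eventually_ge_atTop 1] with k hk
    have hk' : (0 : ℝ) < k := by exact_mod_cast hk
    have hl : 0 < Real.log 2 := Real.log_pos one_lt_two
    have hlog : k * Real.log 2 ≤ Real.log (((2 ^ k : ℕ) : ℝ) + 2) := by
      rw [← Real.log_pow]
      exact Real.log_le_log (by positivity) (by push_cast; linarith)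
    rw [Real.norm_of_nonneg (by positivity)]
    calc (2 : ℝ) ^ k * (1 / ((((2 ^ k : ℕ) : ℝ) + 1) * Real.log (((2 ^ k : ℕ) : ℝ) + 2) ^ 2))
        ≤ (2 : ℝ) ^ k * (1 / ((2 : ℝ) ^ k * (k * Real.log 2) ^ 2)) := by
          gcongr
          push_cast
          linarith
      _ = _ := by field_simp
  · intro t
    positivity
  · intro m n _ hmn
    have := log_add_two_pos m
    gcongr

/-! ### Localized mean square error and pathwise sums of squares. -/

/-- The event that the process `x` stays within `δ` of `xs` during the times `s, …, t`. -/
def stayClose (x : ℕ → Ω → Vec d) (xs : Vec d) (δ : ℝ) (s t : ℕ) : Set Ω :=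
  {ω | ∀ j ∈ Finset.Icc s t, ‖x j ω - xs‖ ≤ δ}

section Recursion

variable {μ : Measure Ω} [IsProbabilityMeasure μ] {ν : Measure Ξ} [IsProbabilityMeasure ν]
  {x₀ : Ω → Vec d} {ξ : ℕ → Ω → Ξ} {G : Vec d → Ξ → Vec d}

omit [MeasurableSpace Ω] in
theorem measurableSet_stayClose (hG : Measurable (Function.uncurry G)) (η : ℕ → ℝ)
    (x₀ : Ω → Vec d) (ξ : ℕ → Ω → Ξ) (xs : Vec d) (δ : ℝ) (s t : ℕ) :
    MeasurableSet[history x₀ ξ t] (stayClose (iter G η x₀ ξ) xs δ s t) := by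
  have e : stayClose (iter G η x₀ ξ) xs δ s t
      = ⋂ j ∈ Finset.Icc s t, iter G η x₀ ξ j ⁻¹' {x | ‖x - xs‖ ≤ δ} := by
    ext ω; simp [stayClose]
  rw [e]
  refine @Finset.measurableSet_biInter _ _ (history x₀ ξ t) _ _ fun j hj => ?_
  exact ((measurable_iter hG η x₀ ξ j).mono (history_mono x₀ ξ (Finset.mem_Icc.1 hj).2) le_rfl)
    (isClosed_le (f := fun x : Vec d => ‖x - xs‖) (by fun_prop) continuous_const).measurableSet

/-- While the recursion stays close to the root, its mean square error is of the order of the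
step sizes. -/
theorem IsDataStream.exists_lintegral_stayClose_le (hdata : IsDataStream μ ν x₀ ξ)
    (hG : Measurable (Function.uncurry G)) {xs : Vec d} {L : ℝ} (hL : 0 ≤ L)
    (hlip : ∀ x y, eLpNorm (fun s => G x s - G y s) 2 ν ≤ ENNReal.ofReal (L * ‖x - y‖))
    (hxs : MemLp (G xs) 2 ν) {V : Vec d → ℝ} (hV : Differentiable ℝ V) (hV0 : V 0 = 0)
    {μV LV lV δ : ℝ} (hμV : 0 < μV) (hVlow : ∀ y, μV * ‖y‖ ^ 2 ≤ V y) (hLV : 0 ≤ LV)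
    (hVlip : ∀ y z, ‖gradient V y - gradient V z‖ ≤ LV * ‖y - z‖)
    (hpos : ∀ x, 0 ≤ inner ℝ (gradient V (x - xs)) (meanField ν G x)) (hlV : 0 < lV)
    (hloc : ∀ x, ‖x - xs‖ ≤ δ →
      lV * V (x - xs) ≤ inner ℝ (gradient V (x - xs)) (meanField ν G x))
    {η₀ a : ℝ} (hη₀ : 0 < η₀) (ha0 : 0 < a) (ha : a < 1) (s : ℕ) :
    ∃ M T, 0 ≤ M ∧ ∀ t, T ≤ t →
      ∫⁻ ω in stayClose (iter G (stepSize η₀ a) x₀ ξ) xs δ s t,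
        ENNReal.ofReal (‖iter G (stepSize η₀ a) x₀ ξ t ω - xs‖ ^ 2) ∂μ
          ≤ ENNReal.ofReal (M * stepSize η₀ a t) := by
  set η := stepSize η₀ a with hη
  set x := iter G η x₀ ξ with hx
  set B := stayClose x xs δ s with hB
  have hη0 : ∀ t, 0 ≤ η t := fun t => (stepSize_pos hη₀ t).le
  have hVnn : ∀ y, 0 ≤ V y := fun y => (by positivity : 0 ≤ μV * ‖y‖ ^ 2).trans (hVlow y)
  obtain ⟨C, hC0, hC⟩ := exists_lyapunov_step hG hL hlip hxs hV hμV hVlow hLV hVlip hpos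
  have hgc : Continuous (meanField ν G) :=
    continuous_of_norm_sub_le hL (norm_meanField_sub_le hG hL hlip hxs)
  have hu : Continuous fun x => inner ℝ (gradient V (x - xs)) (meanField ν G x) :=
    ((continuous_of_norm_sub_le hLV hVlip).comp (continuous_id.sub continuous_const)).inner hgc
  have hVc : Continuous fun x => V (x - xs) := hV.continuous.comp (by fun_prop)
  have hBm : ∀ t, MeasurableSet[history x₀ ξ t] (B t) :=
    measurableSet_stayClose hG η x₀ ξ xs δ s
  have hBm' : ∀ t, MeasurableSet (B t) := fun t => hdata.history_le t _ (hBm t)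
  have hxm : ∀ t, Measurable (x t) := fun t =>
    (measurable_iter hG η x₀ ξ t).mono (hdata.history_le t) le_rfl
  have hVx : ∀ t, Measurable fun ω => ENNReal.ofReal (V (x t ω - xs)) := fun t =>
    (hVc.measurable.comp (hxm t)).ennreal_ofReal
  -- Localization gives access to the drift bound of the `δ`-ball, and also makes these integrals
  -- finite without moments of `x₀`.
  let c : ℕ → ENNReal := fun t => ∫⁻ ω in B t, ENNReal.ofReal (V (x t ω - xs)) ∂μ
  have hcfin : ∀ t, s ≤ t → c t ≠ ⊤ := fun t ht => by
    have h1 : c t ≤ ∫⁻ ω in B t, ENNReal.ofReal (LV * δ ^ 2) ∂μ := by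
      refine setLIntegral_mono measurable_const fun ω hω => ENNReal.ofReal_le_ofReal ?_
      refine (le_mul_norm_sq_of_lipschitz_gradient hV hV0 hVnn hLV hVlip _).trans ?_
      have : ‖x t ω - xs‖ ≤ δ := hω t (Finset.mem_Icc.2 ⟨ht, le_rfl⟩)
      gcongr
    refine (h1.trans_lt ?_).ne
    rw [setLIntegral_const]
    exact ENNReal.mul_lt_top ENNReal.ofReal_lt_top (measure_lt_top _ _)
  have hrec : ∀ t, s ≤ t → (c (t + 1)).toReal + lV * η t * (c t).toReal
      ≤ (1 + C * η t ^ 2) * (c t).toReal + C * η t ^ 2 := fun t ht => by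
    have h1 := hdata.lintegral_iter_succ hG t (η := η)
      (v := fun x => ENNReal.ofReal (V (x - xs)))
      (w := fun x => ENNReal.ofReal (η t * inner ℝ (gradient V (x - xs)) (meanField ν G x)))
      (r := fun x => ENNReal.ofReal ((1 + C * η t ^ 2) * V (x - xs) + C * η t ^ 2))
      hVc.measurable.ennreal_ofReal (hu.measurable.const_mul _).ennreal_ofReal
      (hC (η t) (hη0 t)) (hBm t)
    -- The events shrink in time; `B t`, unlike `B (t + 1)`, belongs to the past of the step.
    have h2 : c (t + 1) ≤ ∫⁻ ω in B t, ENNReal.ofReal (V (x (t + 1) ω - xs)) ∂μ :=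
      lintegral_mono_set fun ω hω j hj => hω j
        (Finset.Icc_subset_Icc_right t.le_succ hj)
    have h3 : ENNReal.ofReal (lV * η t) * c t
        ≤ ∫⁻ ω in B t, ENNReal.ofReal
          (η t * inner ℝ (gradient V (x t ω - xs)) (meanField ν G (x t ω))) ∂μ := by
      rw [← lintegral_const_mul _ (hVx t)]
      refine setLIntegral_mono
        (((hu.measurable.comp (hxm t)).const_mul (η t)).ennreal_ofReal) fun ω hω => ?_
      rw [← ENNReal.ofReal_mul (mul_nonneg hlV.le (hη0 t))]
      refine ENNReal.ofReal_le_ofReal ?_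
      have := mul_le_mul_of_nonneg_left
        (hloc _ (hω t (Finset.mem_Icc.2 ⟨ht, le_rfl⟩))) (hη0 t)
      linarith
    have h4 : ∫⁻ ω in B t, ENNReal.ofReal ((1 + C * η t ^ 2) * V (x t ω - xs) + C * η t ^ 2) ∂μ
        ≤ ENNReal.ofReal (1 + C * η t ^ 2) * c t + ENNReal.ofReal (C * η t ^ 2) := by
      have e : ∀ ω, ENNReal.ofReal ((1 + C * η t ^ 2) * V (x t ω - xs) + C * η t ^ 2)
          = ENNReal.ofReal (1 + C * η t ^ 2) * ENNReal.ofReal (V (x t ω - xs))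
            + ENNReal.ofReal (C * η t ^ 2) := fun ω => by
        rw [ENNReal.ofReal_add (mul_nonneg (by positivity) (hVnn _)) (by positivity),
          ENNReal.ofReal_mul (by positivity)]
      simp only [e]
      rw [lintegral_add_right _ measurable_const, lintegral_const_mul _ (hVx t),
        setLIntegral_const]
      gcongr
      exact mul_le_of_le_one_right' prob_le_one
    have h5 := (add_le_add h2 h3).trans (h1.trans h4)
    have hf1 := hcfin t ht
    have hf2 := hcfin (t + 1) (ht.trans t.le_succ)
    have h6 := ENNReal.toReal_mono (by finiteness) h5
    rwa [ENNReal.toReal_add hf2 (by finiteness), ENNReal.toReal_add (by finiteness)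
      (by finiteness), ENNReal.toReal_mul, ENNReal.toReal_mul,
      ENNReal.toReal_ofReal (mul_nonneg hlV.le (hη0 t)), ENNReal.toReal_ofReal (by positivity),
      ENNReal.toReal_ofReal (by positivity)] at h6
  obtain ⟨M, T, hM, hMT⟩ := exists_le_mul_stepSize hη₀ ha0 ha hlV
    (fun t => ENNReal.toReal_nonneg) hrec
  refine ⟨M / μV, max T s, by positivity, fun t ht => ?_⟩
  have h1 := hMT t (le_of_max_le_left ht)
  have hf := hcfin t (le_of_max_le_right ht)
  calc ∫⁻ ω in B t, ENNReal.ofReal (‖x t ω - xs‖ ^ 2) ∂μ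
      ≤ ∫⁻ ω in B t, ENNReal.ofReal (1 / μV) * ENNReal.ofReal (V (x t ω - xs)) ∂μ := by
        refine lintegral_mono fun ω => ?_
        rw [← ENNReal.ofReal_mul (by positivity)]
        refine ENNReal.ofReal_le_ofReal ?_
        rw [one_div_mul_eq_div, le_div_iff₀ hμV]
        linarith [hVlow (x t ω - xs)]
    _ = ENNReal.ofReal (1 / μV) * c t := lintegral_const_mul _ (hVx t)
    _ ≤ ENNReal.ofReal (1 / μV) * ENNReal.ofReal (M * η t) := by
        gcongr
        exact (ENNReal.le_ofReal_iff_toReal_le hf (mul_nonneg hM (hη0 t))).2 h1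
    _ = ENNReal.ofReal (M / μV * η t) := by
        rw [← ENNReal.ofReal_mul (by positivity)]
        congr 1
        ring

/-- Almost surely, replacing `x_j` by the root `xs` in a mean square Lipschitz function changes
its values along the data by a sequence with squares summing to `O(t^{1-a} log² t)`. -/
theorem IsDataStream.ae_exists_sum_sq_le (hdata : IsDataStream μ ν x₀ ξ)
    (hG : Measurable (Function.uncurry G)) {xs : Vec d} {δ η₀ a : ℝ} (hδ : 0 < δ)
    (hη₀ : 0 < η₀) (ha0 : 0 < a) (ha : a < 1)
    (hconv : ∀ᵐ ω ∂μ, Tendsto (fun t => iter G (stepSize η₀ a) x₀ ξ t ω) atTop (𝓝 xs))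
    (hloc : ∀ s, ∃ M T, 0 ≤ M ∧ ∀ t, T ≤ t →
      ∫⁻ ω in stayClose (iter G (stepSize η₀ a) x₀ ξ) xs δ s t,
        ENNReal.ofReal (‖iter G (stepSize η₀ a) x₀ ξ t ω - xs‖ ^ 2) ∂μ
          ≤ ENNReal.ofReal (M * stepSize η₀ a t))
    {F : Vec d → Ξ → ℝ} (hF : Measurable (Function.uncurry F)) {L : ℝ} (hL : 0 ≤ L)
    (hlip : ∀ x y, eLpNorm (fun s => F x s - F y s) 2 ν ≤ ENNReal.ofReal (L * ‖x - y‖)) :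
    ∀ᵐ ω ∂μ, ∃ K, 0 ≤ K ∧ ∀ t : ℕ, ∑ j ∈ Finset.range t,
      (F (iter G (stepSize η₀ a) x₀ ξ j ω) (ξ j ω) - F xs (ξ j ω)) ^ 2
        ≤ K * (((t : ℝ) + 1) ^ (1 - a) * Real.log ((t : ℝ) + 2) ^ 2) := by
  set η := stepSize η₀ a with hη
  set x := iter G η x₀ ξ with hx
  let D : ℕ → Ω → ℝ := fun j ω => (F (x j ω) (ξ j ω) - F xs (ξ j ω)) ^ 2
  -- Localized means of `D t` are of order `t^{-a}`, so those of `D t / q t` are of order `1 / (t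
  -- log² t)` and summable. Monotonicity of `q` then bounds the sum of `D` up to `t` by a multiple
  -- of `q t`.
  let q : ℕ → ℝ := fun t => ((t : ℝ) + 1) ^ (1 - a) * Real.log ((t : ℝ) + 2) ^ 2
  have hq : ∀ t, 0 < q t := fun t => by have := log_add_two_pos t; positivity
  have hxm : ∀ t, Measurable (x t) := fun t =>
    (measurable_iter hG η x₀ ξ t).mono (hdata.history_le t) le_rfl
  have hDm : ∀ t, Measurable (D t) := fun t =>
    ((hF.comp ((hxm t).prodMk (hdata.measurable_data t))).sub
      (hF.comp (measurable_const.prodMk (hdata.measurable_data t)))).pow_const 2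
  have hD0 : ∀ t ω, 0 ≤ D t ω := fun t ω => sq_nonneg _
  have hDle : ∀ s t, ∫⁻ ω in stayClose x xs δ s t, ENNReal.ofReal (D t ω) ∂μ
      ≤ ENNReal.ofReal (L ^ 2) * ∫⁻ ω in stayClose x xs δ s t,
        ENNReal.ofReal (‖x t ω - xs‖ ^ 2) ∂μ := fun s t => by
    have h1 := hdata.lintegral_data t (measurable_iter hG η x₀ ξ t)
      (f := fun y z => ENNReal.ofReal ((F y z - F xs z) ^ 2))
      ((hF.sub (hF.comp (measurable_const.prodMk measurable_snd))).pow_const 2).ennreal_ofReal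
      (measurableSet_stayClose hG η x₀ ξ xs δ s t)
    rw [h1, ← lintegral_const_mul _ (((hxm t).sub_const xs).norm.pow_const 2).ennreal_ofReal]
    refine lintegral_mono fun ω => ?_
    have h2 := lintegral_enorm_sq_le_of_eLpNorm_le (by positivity) (hlip (x t ω) xs)
    rw [mul_pow, ENNReal.ofReal_mul (by positivity)] at h2
    refine le_trans (le_of_eq ?_) h2
    refine lintegral_congr fun z => ?_
    rw [← ofReal_norm, ← ENNReal.ofReal_pow (norm_nonneg _), Real.norm_eq_abs, sq_abs]
  have key : ∀ s, ∀ᵐ ω ∂μ, (∀ j, s ≤ j → ‖x j ω - xs‖ ≤ δ) →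
      Summable fun t => D t ω / q t := fun s => by
    obtain ⟨M, T, hM, hMT⟩ := hloc s
    -- The shift skips the times before `T` and also time `0`, where the step size is not given by
    -- the power.
    let f : ℕ → Ω → ENNReal := fun i => (stayClose x xs δ s (i + (T + 1))).indicator
      fun ω => ENNReal.ofReal (D (i + (T + 1)) ω / q (i + (T + 1)))
    have hSm : ∀ t, MeasurableSet (stayClose x xs δ s t) := fun t =>
      hdata.history_le t _ (measurableSet_stayClose hG η x₀ ξ xs δ s t)
    have hfm : ∀ i, Measurable (f i) := fun i =>
      ((hDm _).div_const _).ennreal_ofReal.indicator (hSm _)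
    let R : ℝ := L ^ 2 * (M * (η₀ * 2 ^ a))
    have hR : 0 ≤ R := by positivity
    have hfi : ∀ i, ∫⁻ ω, f i ω ∂μ ≤ ENNReal.ofReal (R * (1 / ((((i + (T + 1) : ℕ) : ℝ) + 1)
        * Real.log (((i + (T + 1) : ℕ) : ℝ) + 2) ^ 2))) := fun i => by
      set t := i + (T + 1) with ht
      have ht0 : t ≠ 0 := by omega
      have ht1 : (1 : ℝ) ≤ t := by exact_mod_cast Nat.one_le_iff_ne_zero.2 ht0
      have hlt := log_add_two_pos t
      have h1 : ∫⁻ ω, f i ω ∂μ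
          = ENNReal.ofReal (1 / q t) * ∫⁻ ω in stayClose x xs δ s t,
              ENNReal.ofReal (D t ω) ∂μ := by
        rw [lintegral_indicator (hSm _), ← lintegral_const_mul _ (hDm t).ennreal_ofReal]
        refine lintegral_congr fun ω => ?_
        rw [← ENNReal.ofReal_mul (one_div_nonneg.2 (hq t).le), one_div_mul_eq_div]
      rw [h1]
      refine (mul_le_mul_right ((hDle s t).trans (mul_le_mul_right
        (hMT t (by omega)) _)) _).trans ?_
      rw [← ENNReal.ofReal_mul (by positivity),
        ← ENNReal.ofReal_mul (one_div_nonneg.2 (hq t).le)]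
      refine ENNReal.ofReal_le_ofReal ?_
      have h2 : (t : ℝ) ^ (-a) ≤ 2 ^ a * ((t : ℝ) + 1) ^ (-a) := by
        have h3 : ((t : ℝ) + 1) ^ a ≤ (2 * t) ^ a :=
          Real.rpow_le_rpow (by positivity) (by linarith) ha0.le
        rw [Real.mul_rpow (by norm_num) (by positivity)] at h3
        rw [Real.rpow_neg (by positivity), Real.rpow_neg (by positivity), ← div_eq_mul_inv,
          le_div_iff₀ (by positivity), inv_mul_le_iff₀ (by positivity)]
        linarith
      have h4 : ((t : ℝ) + 1) ^ (-a) = ((t : ℝ) + 1) ^ (1 - a) / ((t : ℝ) + 1) := by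
        rw [sub_eq_neg_add, Real.rpow_add (by positivity), Real.rpow_one]
        field_simp
      rw [hη, stepSize_of_ne_zero _ _ ht0]
      calc 1 / q t * (L ^ 2 * (M * (η₀ * (t : ℝ) ^ (-a))))
          ≤ 1 / q t * (L ^ 2 * (M * (η₀ * (2 ^ a * ((t : ℝ) + 1) ^ (-a))))) := by
            have := hq t
            gcongr
        _ = R * (1 / (((t : ℝ) + 1) * Real.log ((t : ℝ) + 2) ^ 2)) := by
            rw [h4]
            simp only [q, R]
            have : ((t : ℝ) + 1) ^ (1 - a) ≠ 0 := by positivity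
            field_simp
    have hsum : ∫⁻ ω, ∑' i, f i ω ∂μ < ⊤ := by
      rw [lintegral_tsum fun i => (hfm i).aemeasurable]
      refine (ENNReal.tsum_le_tsum hfi).trans_lt ?_
      have hs : Summable fun i : ℕ => R * (1 / ((((i + (T + 1) : ℕ) : ℝ) + 1)
          * Real.log (((i + (T + 1) : ℕ) : ℝ) + 2) ^ 2)) :=
        ((summable_nat_add_iff (T + 1)).2 summable_inv_mul_log_sq).mul_left R
      exact hs.tsum_ofReal_lt_top
    filter_upwards [ae_lt_top (Measurable.tsum hfm) hsum.ne] with ω hω hclose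
    rw [← summable_nat_add_iff (T + 1)]
    have h1 : ∀ i, f i ω = ENNReal.ofReal (D (i + (T + 1)) ω / q (i + (T + 1))) := fun i =>
      Set.indicator_of_mem (s := stayClose x xs δ s (i + (T + 1)))
        (fun j hj => hclose j (Finset.mem_Icc.1 hj).1) _
    simp only [h1] at hω
    have h2 := ENNReal.summable_toReal hω.ne
    refine h2.congr fun i => ?_
    rw [ENNReal.toReal_ofReal (div_nonneg (hD0 _ _) (hq _).le)]
  filter_upwards [hconv, ae_all_iff.2 key] with ω h1 h2
  -- The time `s` depends on the path; this is harmless, as `key` holds almost surely for all `s` at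
  -- once.
  obtain ⟨s, hs⟩ : ∃ s, ∀ j, s ≤ j → ‖x j ω - xs‖ ≤ δ := by
    obtain ⟨s, hs⟩ := Metric.tendsto_atTop.1 h1 δ hδ
    exact ⟨s, fun j hj => by rw [← dist_eq_norm]; exact (hs j hj).le⟩
  have hsum := h2 s hs
  refine ⟨∑' t, D t ω / q t, tsum_nonneg fun t => div_nonneg (hD0 _ _) (hq _).le, fun t => ?_⟩
  have hqm : ∀ j ∈ Finset.range t, q j ≤ q t := fun j hj => by
    have hjt : (j : ℝ) ≤ t := by exact_mod_cast (Finset.mem_range.1 hj).le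
    have := log_add_two_pos j
    have h1a : 0 ≤ 1 - a := by linarith
    simp only [q]
    gcongr
  calc ∑ j ∈ Finset.range t, D j ω ≤ ∑ j ∈ Finset.range t, D j ω / q j * q t := by
        refine Finset.sum_le_sum fun j hj => ?_
        rw [div_mul_eq_mul_div, le_div_iff₀ (hq j)]
        exact mul_le_mul_of_nonneg_left (hqm j hj) (hD0 _ _)
    _ = (∑ j ∈ Finset.range t, D j ω / q j) * q t := by rw [Finset.sum_mul]
    _ ≤ _ := by
        gcongr
        exact hsum.sum_le_tsum _ fun j _ => div_nonneg (hD0 _ _) (hq _).le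

end Recursion

/-! ### Sums of independent variables: martingale convergence and truncation. -/

/-- Bounded partial sums, after multiplication by monotone weights, are of the order of the
last weight. -/
theorem abs_sum_mul_le_of_monotone {b e : ℕ → ℝ} (hb : Monotone b) (hb0 : ∀ n, 0 ≤ b n) {K : ℝ}
    (hK : ∀ n, |∑ j ∈ Finset.range n, e j| ≤ K) (n : ℕ) :
    |∑ j ∈ Finset.range n, b j * e j| ≤ 2 * K * b n := by
  -- Summation by parts, as an induction on the Abel remainder.
  have key : ∀ n, |∑ j ∈ Finset.range n, b j * e j - b n * ∑ j ∈ Finset.range n, e j|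
      ≤ K * (b n - b 0) := fun n => by
    induction n with
    | zero => simp
    | succ n ih =>
      have e1 : ∑ j ∈ Finset.range (n + 1), b j * e j
          - b (n + 1) * ∑ j ∈ Finset.range (n + 1), e j
          = (∑ j ∈ Finset.range n, b j * e j - b n * ∑ j ∈ Finset.range n, e j)
            - (b (n + 1) - b n) * ∑ j ∈ Finset.range (n + 1), e j := by
        simp only [Finset.sum_range_succ]; ring
      have hd : 0 ≤ b (n + 1) - b n := sub_nonneg.2 (hb n.le_succ)
      rw [e1]
      refine (abs_sub _ _).trans ?_
      rw [abs_mul, abs_of_nonneg hd]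
      have := mul_le_mul_of_nonneg_left (hK (n + 1)) hd
      linarith
  have h1 := key n
  have h2 : |b n * ∑ j ∈ Finset.range n, e j| ≤ b n * K := by
    rw [abs_mul, abs_of_nonneg (hb0 n)]
    exact mul_le_mul_of_nonneg_left (hK n) (hb0 n)
  have hK0 : 0 ≤ K := (abs_nonneg _).trans (hK 0)
  have h3 := abs_add_le (∑ j ∈ Finset.range n, b j * e j - b n * ∑ j ∈ Finset.range n, e j)
    (b n * ∑ j ∈ Finset.range n, e j)
  rw [sub_add_cancel] at h3
  nlinarith [mul_nonneg hK0 (hb0 0)]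

section Data

variable {μ : Measure Ω} [IsProbabilityMeasure μ] {ν : Measure Ξ} [IsProbabilityMeasure ν]
  {x₀ : Ω → Vec d} {ξ : ℕ → Ω → Ξ}

omit [IsProbabilityMeasure μ] [IsProbabilityMeasure ν] in
theorem IsDataStream.measurePreserving (hdata : IsDataStream μ ν x₀ ξ) (i : ℕ) :
    MeasurePreserving (ξ i) μ ν := ⟨hdata.measurable_data i, hdata.law i⟩

omit [IsProbabilityMeasure ν] in
/-- A series of independent centered variables with summable variances has bounded partial sums
almost surely. -/
theorem IsDataStream.ae_exists_abs_sum_le_of_summable (hdata : IsDataStream μ ν x₀ ξ)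
    {ψ : ℕ → Ξ → ℝ} (hψ : ∀ j, Measurable (ψ j)) (hψ2 : ∀ j, MemLp (ψ j) 2 ν)
    (hmean : ∀ j, ∫ s, ψ j s ∂ν = 0) (hsum : Summable fun j => ∫ s, ψ j s ^ 2 ∂ν) :
    ∀ᵐ ω ∂μ, ∃ K, ∀ n, |∑ j ∈ Finset.range n, ψ j (ξ j ω)| ≤ K := by
  let Y : ℕ → Ω → ℝ := fun j ω => ψ j (ξ j ω)
  have hmp := hdata.measurePreserving
  have hY2 : ∀ j, MemLp (Y j) 2 μ := fun j => (hψ2 j).comp_measurePreserving (hmp j)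
  have hYm : ∀ j, Measurable (Y j) := fun j => (hψ j).comp (hdata.measurable_data j)
  have hYint : ∀ j, ∫ ω, Y j ω ∂μ = 0 := fun j => by
    rw [← hmean j, ← hdata.law j,
      integral_map (hdata.measurable_data j).aemeasurable (hψ j).aestronglyMeasurable]
  have hYsq : ∀ j, ∫ ω, Y j ω ^ 2 ∂μ = ∫ s, ψ j s ^ 2 ∂ν := fun j => by
    rw [← hdata.law j, integral_map (hdata.measurable_data j).aemeasurable
      ((hψ j).pow_const 2).aestronglyMeasurable]
  let S : ℕ → Ω → ℝ := fun n => ∑ j ∈ Finset.range n, Y j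
  have hS2 : ∀ n, MemLp (S n) 2 μ := fun n => memLp_finsetSum' _ fun j _ => hY2 j
  have hSi : ∀ n, Integrable (S n) μ := fun n => (hS2 n).integrable one_le_two
  have hS0 : ∀ n, ∫ ω, S n ω ∂μ = 0 := fun n => by
    simp only [S, Finset.sum_apply]
    rw [integral_finsetSum _ fun j _ => (hY2 j).integrable one_le_two]
    exact Finset.sum_eq_zero fun j _ => hYint j
  have hSsq : ∀ n, ∫ ω, S n ω ^ 2 ∂μ ≤ ∑' j, ∫ s, ψ j s ^ 2 ∂ν := fun n => by
    rw [← variance_of_integral_eq_zero (hS2 n).1.aemeasurable (hS0 n),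
      IndepFun.variance_sum (fun j _ => hY2 j) fun i _ j _ hij =>
        (hdata.indep.indepFun hij).comp (hψ i) (hψ j)]
    calc ∑ j ∈ Finset.range n, variance (Y j) μ
        = ∑ j ∈ Finset.range n, ∫ s, ψ j s ^ 2 ∂ν := Finset.sum_congr rfl fun j _ => by
          rw [variance_of_integral_eq_zero (hYm j).aemeasurable (hYint j), hYsq]
      _ ≤ _ := hsum.sum_le_tsum _ fun j _ => integral_nonneg fun s => sq_nonneg _
  -- The partial sums form a martingale bounded in `L²`, so they converge almost surely; only
  -- boundedness of the paths is kept.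
  have hmart : Martingale S hdata.filtration μ := by
    refine martingale_of_condExp_sub_eq_zero_nat (fun n => ?_) hSi fun n => ?_
    · refine Measurable.stronglyMeasurable ?_
      have e : S n = fun ω => ∑ j ∈ Finset.range n, Y j ω := by
        funext ω; simp only [S, Finset.sum_apply]
      rw [e]
      exact Finset.measurable_sum _ fun j hj =>
        (hψ j).comp (measurable_data_history x₀ ξ (Finset.mem_range.1 hj))
    · have e : S (n + 1) - S n = Y n := by
        simp only [S, Finset.sum_range_succ, add_sub_cancel_left]
      rw [e]
      have := condExp_indep_eq (μ := μ) (hdata.measurable_data n).comap_le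
        (hdata.history_le n) (f := Y n)
        ((hψ n).comp (comap_measurable (ξ n))).stronglyMeasurable (hdata.indep_history n).symm
      refine this.trans (Eventually.of_forall fun ω => ?_)
      exact hYint n
  have hbdd : ∀ n, eLpNorm (S n) 1 μ ≤ (1 + ∑' j, ∫ s, ψ j s ^ 2 ∂ν).toNNReal := fun n => by
    rw [eLpNorm_one_eq_lintegral_enorm, ← ofReal_integral_norm_eq_lintegral_enorm (hSi n)]
    refine ENNReal.ofReal_le_ofReal ?_
    have i2 : Integrable (fun ω => S n ω ^ 2) μ := (hS2 n).integrable_sq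
    calc ∫ ω, ‖S n ω‖ ∂μ ≤ ∫ ω, (1 + S n ω ^ 2) ∂μ := by
          refine integral_mono (hSi n).norm ((integrable_const _).add i2) fun ω => ?_
          simp only [Real.norm_eq_abs]
          nlinarith [sq_nonneg (|S n ω| - 1), sq_abs (S n ω), abs_nonneg (S n ω)]
      _ = 1 + ∫ ω, S n ω ^ 2 ∂μ := by
          rw [integral_add (integrable_const _) i2]; simp
      _ ≤ _ := by linarith [hSsq n]
  filter_upwards [hmart.submartingale.exists_ae_tendsto_of_bdd hbdd] with ω ⟨c, hc⟩
  obtain ⟨K, hK⟩ := hc.abs.bddAbove_range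
  refine ⟨K, fun n => ?_⟩
  have := hK ⟨n, rfl⟩
  simpa [S, Y] using this

end Data

theorem sum_inv_succ_le (n : ℕ) :
    ∑ j ∈ Finset.range n, 1 / ((j : ℝ) + 1) ≤ (1 / Real.log 2 + 1) * Real.log ((n : ℝ) + 2) := by
  have h1 := harmonic_le_one_add_log n
  have h2 : ((harmonic n : ℚ) : ℝ) = ∑ j ∈ Finset.range n, 1 / ((j : ℝ) + 1) := by
    simp [harmonic]
  have hl : 0 < Real.log 2 := Real.log_pos one_lt_two
  have h3 : Real.log 2 ≤ Real.log ((n : ℝ) + 2) :=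
    Real.log_le_log two_pos (by linarith [(Nat.cast_nonneg n : (0 : ℝ) ≤ n)])
  have h4 : Real.log n ≤ Real.log ((n : ℝ) + 2) := by
    rcases n.eq_zero_or_pos with rfl | hn
    · simp [hl.le]
    · exact Real.log_le_log (by exact_mod_cast hn) (by linarith)
  have h5 : 1 ≤ 1 / Real.log 2 * Real.log ((n : ℝ) + 2) := by
    rw [one_div_mul_eq_div, le_div_iff₀ hl]; linarith
  rw [← h2]
  linarith

section Truncation

variable {ν : Measure Ξ} {φ : Ξ → ℝ}

/-- Truncation of a function at level `c`. -/
def cutoff (φ : Ξ → ℝ) (c : ℝ) (s : Ξ) : ℝ := {s | |φ s| ≤ c}.indicator φ s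

theorem measurable_cutoff (hφ : Measurable φ) (c : ℝ) : Measurable (cutoff φ c) :=
  hφ.indicator (measurableSet_le hφ.abs measurable_const)

omit [MeasurableSpace Ξ] in
theorem abs_cutoff_le {c : ℝ} (hc : 0 ≤ c) (s : Ξ) : |cutoff φ c s| ≤ c := by
  unfold cutoff
  by_cases h : |φ s| ≤ c
  · rw [Set.indicator_of_mem (by exact h)]; exact h
  · rw [Set.indicator_of_notMem (by exact h)]; simpa using hc

omit [MeasurableSpace Ξ] in
-- Below the level, `|φ|^{2-q} ≤ c^{2-q}` since `q ≤ 2`. This bounds the variance after truncation.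
theorem cutoff_sq_le {c q : ℝ} (hc : 0 ≤ c) (hq : 0 < q) (hq2 : q ≤ 2) (s : Ξ) :
    cutoff φ c s ^ 2 ≤ c ^ (2 - q) * |φ s| ^ q := by
  unfold cutoff
  by_cases h : |φ s| ≤ c
  · rw [Set.indicator_of_mem (by exact h)]
    rcases (abs_nonneg (φ s)).eq_or_lt with h0 | h0
    · have : φ s = 0 := abs_eq_zero.1 h0.symm
      simp [this, Real.zero_rpow hq.ne']
    · calc φ s ^ 2 = |φ s| ^ (2 - q) * |φ s| ^ q := by
            rw [← Real.rpow_add h0, sub_add_cancel, ← sq_abs]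
            exact_mod_cast (Real.rpow_natCast _ 2).symm
        _ ≤ _ := by gcongr
  · rw [Set.indicator_of_notMem (by exact h)]
    have : 0 ≤ c ^ (2 - q) * |φ s| ^ q := by positivity
    simpa using this

omit [MeasurableSpace Ξ] in
-- Above the level, `|φ|^{1-q} ≤ c^{1-q}`, the exponent being negative. This bounds the bias of
-- truncation.
theorem abs_sub_cutoff_le {c q : ℝ} (hc : 0 < c) (hq : 1 < q) (s : Ξ) :
    |φ s - cutoff φ c s| ≤ c ^ (1 - q) * |φ s| ^ q := by
  unfold cutoff
  by_cases h : |φ s| ≤ c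
  · rw [Set.indicator_of_mem (by exact h)]
    simp only [sub_self, abs_zero]
    positivity
  · rw [Set.indicator_of_notMem (by exact h), sub_zero]
    push Not at h
    have h0 : 0 < |φ s| := hc.trans h
    calc |φ s| = |φ s| ^ (1 - q) * |φ s| ^ q := by
          rw [← Real.rpow_add h0, sub_add_cancel, Real.rpow_one]
      _ ≤ _ := by
          gcongr ?_ * _
          exact Real.rpow_le_rpow_of_nonpos hc h.le (by linarith)

end Truncation

section Data

variable {μ : Measure Ω} [IsProbabilityMeasure μ] {ν : Measure Ξ} [IsProbabilityMeasure ν]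
  {x₀ : Ω → Vec d} {ξ : ℕ → Ω → Ξ}

/-- Strong law of large numbers with a rate, for variables with a moment of order `q ∈ (1, 2]`
(Marcinkiewicz–Zygmund, up to a logarithm). -/
theorem IsDataStream.ae_exists_abs_sum_sub_le (hdata : IsDataStream μ ν x₀ ξ) {φ : Ξ → ℝ}
    (hφ : Measurable φ) {q : ℝ} (hq : 1 < q) (hq2 : q ≤ 2)
    (hmem : MemLp φ (ENNReal.ofReal q) ν) :
    ∀ᵐ ω ∂μ, ∃ K, 0 ≤ K ∧ ∀ n : ℕ, |∑ j ∈ Finset.range n, (φ (ξ j ω) - ∫ s, φ s ∂ν)|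
      ≤ K * (((n : ℝ) + 1) ^ (1 / q) * Real.log ((n : ℝ) + 2)) := by
  have hq0 : 0 < q := by linarith
  have hφi : Integrable φ ν := hmem.integrable (by simpa using hq.le)
  have hφq : Integrable (fun s => |φ s| ^ q) ν := by
    have := hmem.integrable_norm_rpow (by simpa using hq0) ENNReal.ofReal_ne_top
    simpa [ENNReal.toReal_ofReal hq0.le] using this
  set m := ∫ s, |φ s| ^ q ∂ν with hm
  have hm0 : 0 ≤ m := integral_nonneg fun s => by positivity
  -- At this level the probabilities of being truncated are summable, the bias is at most `m * c j /
  -- (j + 1)`, and the variance divided by `c j ^ 2` is at most `m / (j + 1)`; the logarithm in `b`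
  -- makes the last series converge.
  let c : ℕ → ℝ := fun j => ((j : ℝ) + 1) ^ (1 / q)
  have hc : ∀ j, 0 < c j := fun j => by positivity
  have hcrpow : ∀ j r, c j ^ r = ((j : ℝ) + 1) ^ (r / q) := fun j r => by
    simp only [c]
    rw [← Real.rpow_mul (by positivity), one_div_mul_eq_div]
  let b : ℕ → ℝ := fun j => c j * Real.log ((j : ℝ) + 2)
  have hb0 : ∀ j, 0 < b j := fun j => mul_pos (hc j) (log_add_two_pos j)
  have hbm : Monotone b := fun i j hij => by
    have hij' : (i : ℝ) ≤ j := by exact_mod_cast hij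
    have := log_add_two_pos i
    simp only [b, c]
    gcongr
  let τ : ℕ → Ξ → ℝ := fun j => cutoff φ (c j)
  have hτm : ∀ j, Measurable (τ j) := fun j => measurable_cutoff hφ _
  have hτ2 : ∀ j, MemLp (τ j) 2 ν := fun j =>
    MemLp.of_bound (hτm j).aestronglyMeasurable (c j)
      (Eventually.of_forall fun s => abs_cutoff_le (hc j).le s)
  have hτi : ∀ j, Integrable (τ j) ν := fun j => (hτ2 j).integrable one_le_two
  let ψ : ℕ → Ξ → ℝ := fun j s => (τ j s - ∫ z, τ j z ∂ν) / b j
  have hψm : ∀ j, Measurable (ψ j) := fun j => ((hτm j).sub_const _).div_const _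
  have hτc2 : ∀ j, MemLp (fun s => τ j s - ∫ z, τ j z ∂ν) 2 ν := fun j =>
    (hτ2 j).sub (memLp_const _)
  have hψ2 : ∀ j, MemLp (ψ j) 2 ν := fun j => by
    simpa only [ψ, div_eq_mul_inv] using (hτc2 j).mul_const (b j)⁻¹
  have hψ0 : ∀ j, ∫ s, ψ j s ∂ν = 0 := fun j => by
    simp only [ψ]
    rw [integral_div, integral_sub (hτi j) (integrable_const _)]
    simp
  have hψsq : ∀ j, ∫ s, ψ j s ^ 2 ∂ν
      ≤ m * (1 / (((j : ℝ) + 1) * Real.log ((j : ℝ) + 2) ^ 2)) := fun j => by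
    have h1 : ∫ s, (τ j s - ∫ z, τ j z ∂ν) ^ 2 ∂ν ≤ ∫ s, τ j s ^ 2 ∂ν := by
      rw [← variance_eq_integral (hτm j).aemeasurable]
      exact variance_le_expectation_sq (hτm j).aestronglyMeasurable
    have h2 : ∫ s, τ j s ^ 2 ∂ν ≤ c j ^ (2 - q) * m := by
      rw [hm, ← integral_const_mul]
      exact integral_mono (hτ2 j).integrable_sq (hφq.const_mul _) fun s =>
        cutoff_sq_le (hc j).le hq0 hq2 s
    have hl := log_add_two_pos j
    have h3 : c j ^ (2 - q) / c j ^ 2 = 1 / ((j : ℝ) + 1) := by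
      rw [← Real.rpow_natCast (c j) 2, ← Real.rpow_sub (hc j), hcrpow]
      have : (2 - q - ((2 : ℕ) : ℝ)) / q = -1 := by push_cast; field_simp; ring
      rw [this, Real.rpow_neg_one, one_div]
    simp only [ψ, div_pow]
    rw [integral_div]
    calc (∫ s, (τ j s - ∫ z, τ j z ∂ν) ^ 2 ∂ν) / b j ^ 2
        ≤ c j ^ (2 - q) * m / b j ^ 2 := by
          have := hb0 j
          gcongr
          exact h1.trans h2
      _ = m * (c j ^ (2 - q) / c j ^ 2 / Real.log ((j : ℝ) + 2) ^ 2) := by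
          simp only [b, mul_pow]
          have := (hc j).ne'
          field_simp
      _ = _ := by rw [h3, div_div]
  have hψsum : Summable fun j => ∫ s, ψ j s ^ 2 ∂ν :=
    Summable.of_nonneg_of_le (fun j => integral_nonneg fun s => sq_nonneg _) hψsq
      (summable_inv_mul_log_sq.mul_left m)
  have hbias : ∀ j, |∫ s, τ j s ∂ν - ∫ s, φ s ∂ν| ≤ m * (c j * (1 / ((j : ℝ) + 1))) :=
    fun j => by
    rw [abs_sub_comm, ← integral_sub hφi (hτi j)]
    have h3 : c j ^ (1 - q) = c j * (1 / ((j : ℝ) + 1)) := by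
      rw [Real.rpow_sub (hc j), Real.rpow_one, hcrpow, div_self hq0.ne', Real.rpow_one]
      ring
    calc |∫ s, (φ s - τ j s) ∂ν| ≤ ∫ s, |φ s - τ j s| ∂ν := abs_integral_le_integral_abs
      _ ≤ ∫ s, c j ^ (1 - q) * |φ s| ^ q ∂ν :=
          integral_mono (hφi.sub (hτi j)).abs (hφq.const_mul _) fun s =>
            abs_sub_cutoff_le (hc j) hq s
      _ = m * (c j * (1 / ((j : ℝ) + 1))) := by
          rw [integral_const_mul, h3, mul_comm]
  -- Borel–Cantelli: integrability of `|φ|^q` makes the tail probabilities at the levels `j`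
  -- summable.
  have hBC : ∀ᵐ ω ∂μ, ∀ᶠ j in atTop, τ j (ξ j ω) = φ (ξ j ω) := by
    have h1 : ∑' j : ℕ, ν {s | |φ s| ^ q ∈ Set.Ioi (j : ℝ)} < ⊤ :=
      @tsum_prob_mem_Ioi_lt_top Ξ ⟨ν⟩ ‹_› _ hφq fun s => by positivity
    have h2 : ∀ j : ℕ, μ (ξ j ⁻¹' {s | |φ s| ^ q ∈ Set.Ioi (j : ℝ)})
        = ν {s | |φ s| ^ q ∈ Set.Ioi (j : ℝ)} := fun j =>
      (hdata.measurePreserving j).measure_preimage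
        ((hφ.abs.pow_const q) measurableSet_Ioi).nullMeasurableSet
    have h3 : ∑' j : ℕ, μ (ξ j ⁻¹' {s | |φ s| ^ q ∈ Set.Ioi (j : ℝ)}) ≠ ⊤ := by
      simpa only [h2] using h1.ne
    filter_upwards [ae_eventually_notMem h3] with ω hω
    filter_upwards [hω] with j hj
    have h4 : |φ (ξ j ω)| ^ q ≤ j := by simpa using hj
    refine Set.indicator_of_mem (s := {s | |φ s| ≤ c j}) ?_ _
    change |φ (ξ j ω)| ≤ ((j : ℝ) + 1) ^ (1 / q)
    rw [one_div, Real.le_rpow_inv_iff_of_pos (abs_nonneg _) (by positivity) hq0]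
    linarith
  have hl2 : 0 < Real.log 2 := Real.log_pos one_lt_two
  filter_upwards [hBC, hdata.ae_exists_abs_sum_le_of_summable hψm hψ2 hψ0 hψsum]
    with ω hω ⟨K, hK⟩
  have hsum1 : Summable fun j => |φ (ξ j ω) - τ j (ξ j ω)| := by
    refine summable_of_hasFiniteSupport ?_
    obtain ⟨J, hJ⟩ := eventually_atTop.1 hω
    refine (Set.finite_Iio J).subset fun j hj => ?_
    by_contra hjJ
    refine hj ?_
    simp only [Set.mem_Iio, not_lt] at hjJ
    simp only [hJ j hjJ, sub_self, abs_zero]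
  set K1 := ∑' j, |φ (ξ j ω) - τ j (ξ j ω)| with hK1
  have hK10 : 0 ≤ K1 := tsum_nonneg fun j => abs_nonneg _
  have hK0 : 0 ≤ K := (abs_nonneg _).trans (hK 0)
  refine ⟨K1 / Real.log 2 + 2 * K + m * (1 / Real.log 2 + 1), by positivity, fun n => ?_⟩
  change _ ≤ _ * b n
  -- Truncated part, centred truncated variables, and bias. The first has finitely many nonzero
  -- terms, the second is a weighted martingale, the third is a harmonic sum.
  have e : ∑ j ∈ Finset.range n, (φ (ξ j ω) - ∫ s, φ s ∂ν)
      = ∑ j ∈ Finset.range n, (φ (ξ j ω) - τ j (ξ j ω))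
        + ∑ j ∈ Finset.range n, b j * ψ j (ξ j ω)
        + ∑ j ∈ Finset.range n, (∫ s, τ j s ∂ν - ∫ s, φ s ∂ν) := by
    rw [← Finset.sum_add_distrib, ← Finset.sum_add_distrib]
    refine Finset.sum_congr rfl fun j _ => ?_
    have := (hb0 j).ne'
    simp only [ψ]
    field_simp
    ring
  have hb2 : Real.log 2 ≤ b n := by
    have h1 : 1 ≤ c n := Real.one_le_rpow (by linarith [(Nat.cast_nonneg n : (0 : ℝ) ≤ n)])
      (by positivity)
    have h2 : Real.log 2 ≤ Real.log ((n : ℝ) + 2) :=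
      Real.log_le_log two_pos (by linarith [(Nat.cast_nonneg n : (0 : ℝ) ≤ n)])
    simp only [b]
    nlinarith [log_add_two_pos n]
  have t1 : |∑ j ∈ Finset.range n, (φ (ξ j ω) - τ j (ξ j ω))| ≤ K1 / Real.log 2 * b n := by
    calc |∑ j ∈ Finset.range n, (φ (ξ j ω) - τ j (ξ j ω))|
        ≤ ∑ j ∈ Finset.range n, |φ (ξ j ω) - τ j (ξ j ω)| := Finset.abs_sum_le_sum_abs _ _
      _ ≤ K1 := hsum1.sum_le_tsum _ fun j _ => abs_nonneg _
      _ ≤ _ := by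
          rw [div_mul_eq_mul_div, le_div_iff₀ hl2]
          exact mul_le_mul_of_nonneg_left hb2 hK10
  have t2 := abs_sum_mul_le_of_monotone hbm (fun j => (hb0 j).le) hK n
  have t3 : |∑ j ∈ Finset.range n, (∫ s, τ j s ∂ν - ∫ s, φ s ∂ν)|
      ≤ m * (1 / Real.log 2 + 1) * b n := by
    calc |∑ j ∈ Finset.range n, (∫ s, τ j s ∂ν - ∫ s, φ s ∂ν)|
        ≤ ∑ j ∈ Finset.range n, |∫ s, τ j s ∂ν - ∫ s, φ s ∂ν| := Finset.abs_sum_le_sum_abs _ _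
      _ ≤ ∑ j ∈ Finset.range n, m * (c n * (1 / ((j : ℝ) + 1))) := by
          refine Finset.sum_le_sum fun j hj => (hbias j).trans ?_
          have hjn : (j : ℝ) ≤ n := by exact_mod_cast (Finset.mem_range.1 hj).le
          simp only [c]
          gcongr
      _ = m * (c n * ∑ j ∈ Finset.range n, 1 / ((j : ℝ) + 1)) := by
          rw [Finset.mul_sum, Finset.mul_sum]
      _ ≤ m * (c n * ((1 / Real.log 2 + 1) * Real.log ((n : ℝ) + 2))) := by
          have := sum_inv_succ_le n
          have := hc n
          gcongr
      _ = _ := by simp only [b]; ring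
  rw [e]
  have h1 := abs_add_three (∑ j ∈ Finset.range n, (φ (ξ j ω) - τ j (ξ j ω)))
    (∑ j ∈ Finset.range n, b j * ψ j (ξ j ω))
    (∑ j ∈ Finset.range n, (∫ s, τ j s ∂ν - ∫ s, φ s ∂ν))
  linarith

end Data

/-! ### Identification of the limiting covariance. -/

section Recursion

variable {μ : Measure Ω} [IsProbabilityMeasure μ] {ν : Measure Ξ} [IsProbabilityMeasure ν]
  {x₀ : Ω → Vec d} {ξ : ℕ → Ω → Ξ}

/-- The conditional expectation of a nonnegative function of the past and of a new data point
is bounded by a bound for its expectation with the past held fixed. -/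
theorem IsDataStream.condExp_le (hdata : IsDataStream μ ν x₀ ξ) (t : ℕ) {X : Ω → Vec d}
    (hX : Measurable[history x₀ ξ t] X) {f : Vec d → Ξ → ℝ}
    (hf : Measurable (Function.uncurry f)) (hf0 : ∀ x s, 0 ≤ f x s) {φ : Vec d → ℝ}
    (hφ0 : ∀ x, 0 ≤ φ x)
    (hle : ∀ x, ∫⁻ s, ENNReal.ofReal (f x s) ∂ν ≤ ENNReal.ofReal (φ x))
    (hint : Integrable (fun ω => f (X ω) (ξ t ω)) μ) :
    ∀ᵐ ω ∂μ, (μ[fun ω' => f (X ω') (ξ t ω') | history x₀ ξ t]) ω ≤ φ (X ω) := by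
  let ψ : Vec d → ENNReal := fun x => ∫⁻ s, ENNReal.ofReal (f x s) ∂ν
  have hψm : Measurable ψ := (hf.ennreal_ofReal).lintegral_prod_right'
  have hψt : ∀ x, ψ x ≠ ⊤ := fun x => ((hle x).trans_lt ENNReal.ofReal_lt_top).ne
  have hψX : Measurable[history x₀ ξ t] fun ω => (ψ (X ω)).toReal :=
    (hψm.comp hX).ennreal_toReal
  have hXm : Measurable X := hX.mono (hdata.history_le t) le_rfl
  have hset : ∀ A, MeasurableSet[history x₀ ξ t] A →
      ∫⁻ ω in A, ENNReal.ofReal (f (X ω) (ξ t ω)) ∂μ = ∫⁻ ω in A, ψ (X ω) ∂μ := fun A hA =>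
    hdata.lintegral_data t hX (f := fun x s => ENNReal.ofReal (f x s)) hf.ennreal_ofReal hA
  have hψint : Integrable (fun ω => (ψ (X ω)).toReal) μ := by
    refine integrable_toReal_of_lintegral_ne_top (hψm.comp hXm).aemeasurable ?_
    have h1 := hset Set.univ MeasurableSet.univ
    simp only [Measure.restrict_univ] at h1
    have h2 := (hasFiniteIntegral_iff_ofReal (Eventually.of_forall fun ω => hf0 _ _)).1 hint.2
    rw [h1] at h2
    exact h2.ne
  have key : (fun ω => (ψ (X ω)).toReal)
      =ᵐ[μ] μ[fun ω' => f (X ω') (ξ t ω') | history x₀ ξ t] := by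
    refine ae_eq_condExp_of_forall_setIntegral_eq (hdata.history_le t) hint
      (fun A _ _ => hψint.integrableOn) (fun A hA _ => ?_)
      hψX.stronglyMeasurable.aestronglyMeasurable
    rw [integral_toReal (by exact (hψm.comp hXm).aemeasurable)
        (Eventually.of_forall fun ω => (hψt _).lt_top),
      integral_eq_lintegral_of_nonneg_ae (Eventually.of_forall fun ω => hf0 _ _)
        hint.1.restrict, hset A hA]
  filter_upwards [key] with ω hω
  rw [← hω]
  exact ENNReal.toReal_le_of_le_ofReal (hφ0 _) (hle _)

variable {G : Vec d → Ξ → Vec d} {η : ℕ → ℝ} {xs : Vec d} {S : Mat d}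

theorem abs_apply_le_norm (v : Vec d) (i : Fin d) : |v i| ≤ ‖v‖ := by
  simpa using PiLp.norm_apply_le v i

/-- The sum `e + Φ` is the error, because the noise at the root is `-G xs`; the sign cancels in
products. The cross terms are split by Young's inequality with weight `c`. -/
theorem abs_mul_sub_mul_le {e Φ : Vec d} {c : ℝ} (hc : 0 < c) (i k : Fin d) :
    |e i * e k - Φ i * Φ k| ≤ c * ‖Φ‖ ^ 2 + (1 + 1 / c) * ‖e + Φ‖ ^ 2 := by
  set R := e + Φ with hR
  have h1 : ∀ j, e j = R j - Φ j := fun j => by simp [hR]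
  have h2 : e i * e k - Φ i * Φ k = R i * R k - R i * Φ k - Φ i * R k := by
    rw [h1, h1]; ring
  have hi := abs_apply_le_norm R i
  have hk := abs_apply_le_norm R k
  have hi' := abs_apply_le_norm Φ i
  have hk' := abs_apply_le_norm Φ k
  have h3 : |R i * R k| ≤ ‖R‖ * ‖R‖ := by rw [abs_mul]; gcongr
  have h4 : |R i * Φ k| ≤ ‖R‖ * ‖Φ‖ := by rw [abs_mul]; gcongr
  have h5 : |Φ i * R k| ≤ ‖Φ‖ * ‖R‖ := by rw [abs_mul]; gcongr
  have h6 : 2 * (‖R‖ * ‖Φ‖) ≤ c * ‖Φ‖ ^ 2 + 1 / c * ‖R‖ ^ 2 := by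
    have : c * ‖Φ‖ ^ 2 + 1 / c * ‖R‖ ^ 2 - 2 * (‖R‖ * ‖Φ‖) = (c * ‖Φ‖ - ‖R‖) ^ 2 / c := by
      field_simp; ring
    have h7 : 0 ≤ (c * ‖Φ‖ - ‖R‖) ^ 2 / c := by positivity
    linarith
  rw [h2]
  have h8 := abs_sub (R i * R k - R i * Φ k) (Φ i * R k)
  have h9 := abs_sub (R i * R k) (R i * Φ k)
  nlinarith

theorem norm_add_sq_le_two {E : Type*} [SeminormedAddCommGroup E] (u v : E) :
    ‖u + v‖ ^ 2 ≤ 2 * ‖u‖ ^ 2 + 2 * ‖v‖ ^ 2 := by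
  have := norm_add_le u v
  nlinarith [norm_nonneg (u + v), sq_nonneg (‖u‖ - ‖v‖)]

/-- The limiting noise covariance is the second moment of `G` at the root. -/
theorem IsDataStream.covariance_eq (hdata : IsDataStream μ ν x₀ ξ)
    (hG : Measurable (Function.uncurry G)) (hroot : meanField ν G xs = 0) {L : ℝ} (hL : 0 ≤ L)
    (hlip : ∀ x y, eLpNorm (fun s => G x s - G y s) 2 ν ≤ ENNReal.ofReal (L * ‖x - y‖))
    (hxs : MemLp (G xs) 2 ν)
    (hconv : ∀ᵐ ω ∂μ, Tendsto (fun t => iter G η x₀ ξ t ω) atTop (𝓝 xs))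
    (hnoise2 : ∀ t, MemLp (noise ν G η x₀ ξ t) 2 μ) {e₀ : ℕ → Ω → Vec d}
    {ζ : ℕ → Vec d → Ω → Vec d}
    (hdec : IsNoiseDecomposition μ (history x₀ ξ) (iter G η x₀ ξ) xs (noise ν G η x₀ ξ) S e₀ ζ)
    (i k : Fin d) : S i k = ∫ s, G xs s i * G xs s k ∂ν := by
  set x := iter G η x₀ ξ with hx
  have hGxs : Measurable (G xs) := hG.comp measurable_prodMk_left
  have hgm : Measurable (meanField ν G) :=
    (continuous_of_norm_sub_le hL (norm_meanField_sub_le hG hL hlip hxs)).measurable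
  let Φ : ℕ → Ω → Vec d := fun t ω => G xs (ξ t ω)
  have hΦ2 : ∀ t, MemLp (Φ t) 2 μ := fun t =>
    hxs.comp_measurePreserving (hdata.measurePreserving t)
  let Z : ℕ → Ω → Vec d := fun t ω => ζ t (x t ω) ω
  have hZ2 : ∀ t, MemLp (Z t) 2 μ := fun t => by
    refine ((hnoise2 t).sub (hdec.memLp t)).ae_eq ?_
    filter_upwards [hdec.decomp t] with ω hω
    simp only [Pi.sub_apply, Z, hω, add_sub_cancel_left]
  -- At `y = x t` this is the squared norm of the noise plus `G xs (ξ t)`. As `g` vanishes at the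
  -- root, both terms are controlled by the Lipschitz constant.
  let f : Vec d → Ξ → ℝ := fun y s => ‖meanField ν G y - (G y s - G xs s)‖ ^ 2
  have hfm : Measurable (Function.uncurry f) :=
    ((hgm.comp measurable_fst).sub (hG.sub (hGxs.comp measurable_snd))).norm.pow_const 2
  have hD2 : ∀ t, MemLp (fun ω => noise ν G η x₀ ξ t ω + Φ t ω) 2 μ := fun t =>
    (hnoise2 t).add (hΦ2 t)
  have hfD : ∀ t ω, f (x t ω) (ξ t ω) = ‖noise ν G η x₀ ξ t ω + Φ t ω‖ ^ 2 := fun t ω => by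
    simp only [f, noise, Φ, hx]
    congr 2
    abel
  have hfi : ∀ t, Integrable (fun ω => f (x t ω) (ξ t ω)) μ := fun t => by
    simp only [hfD]
    exact (hD2 t).integrable_norm_pow two_ne_zero
  have hfle : ∀ y, ∫⁻ s, ENNReal.ofReal (f y s) ∂ν
      ≤ ENNReal.ofReal (4 * L ^ 2 * ‖y - xs‖ ^ 2) := fun y => by
    have hg : ‖meanField ν G y‖ ≤ L * ‖y - xs‖ := by
      simpa [hroot] using norm_meanField_sub_le hG hL hlip hxs y xs
    have h1 := lintegral_enorm_sq_le_of_eLpNorm_le (by positivity) (hlip y xs)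
    calc ∫⁻ s, ENNReal.ofReal (f y s) ∂ν
        ≤ ∫⁻ s, (ENNReal.ofReal (2 * (L * ‖y - xs‖) ^ 2)
            + ENNReal.ofReal 2 * ‖G y s - G xs s‖ₑ ^ 2) ∂ν := by
          refine lintegral_mono fun s => ?_
          rw [← ofReal_norm, ← ENNReal.ofReal_pow (norm_nonneg _),
            ← ENNReal.ofReal_mul zero_le_two, ← ENNReal.ofReal_add (by positivity)
              (by positivity)]
          refine ENNReal.ofReal_le_ofReal ?_
          simp only [f]
          rw [sub_eq_add_neg]
          refine (norm_add_sq_le_two _ _).trans ?_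
          rw [norm_neg]
          gcongr
      _ = ENNReal.ofReal (2 * (L * ‖y - xs‖) ^ 2)
            + ENNReal.ofReal 2 * ∫⁻ s, ‖G y s - G xs s‖ₑ ^ 2 ∂ν := by
          rw [lintegral_add_left measurable_const, lintegral_const, measure_univ, mul_one,
            lintegral_const_mul]
          exact ((hG.comp measurable_prodMk_left).sub hGxs).enorm.pow_const 2
      _ ≤ ENNReal.ofReal (2 * (L * ‖y - xs‖) ^ 2)
            + ENNReal.ofReal 2 * ENNReal.ofReal ((L * ‖y - xs‖) ^ 2) := by gcongr
      _ = ENNReal.ofReal (4 * L ^ 2 * ‖y - xs‖ ^ 2) := by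
          rw [← ENNReal.ofReal_mul zero_le_two, ← ENNReal.ofReal_add (by positivity)
              (by positivity)]
          congr 1
          ring
  set m := ∫ s, ‖G xs s‖ ^ 2 ∂ν with hm
  have hm0 : 0 ≤ m := integral_nonneg fun s => by positivity
  have hindep : ∀ t {h : Ξ → ℝ}, Measurable h →
      μ[fun ω => h (ξ t ω) | history x₀ ξ t] =ᵐ[μ] fun _ => ∫ s, h s ∂ν := fun t h hh => by
    have h1 := condExp_indep_eq (μ := μ) (hdata.measurable_data t).comap_le
      (hdata.history_le t) (f := fun ω => h (ξ t ω))
      (hh.comp (comap_measurable (ξ t))).stronglyMeasurable (hdata.indep_history t).symm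
    rw [← hdata.law t, integral_map (hdata.measurable_data t).aemeasurable
      hh.aestronglyMeasurable]
    exact h1
  have hcoord : ∀ j, Measurable fun s => G xs s j := fun j =>
    (PiLp.continuous_apply 2 _ j).measurable.comp hGxs
  obtain ⟨δ, hδ, hrem⟩ := hdec.remainder
  obtain ⟨T, hT⟩ := eventually_atTop.1 hrem
  -- For fixed `c` the error terms vanish as `t → ∞`, leaving the Young term `c * m`; `c` is sent to
  -- zero afterwards.
  have hmain : ∀ c : ℝ, 0 < c → |S i k - ∫ s, G xs s i * G xs s k ∂ν| ≤ c * m := fun c hc => by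
    have hbound : ∀ t, T ≤ t → ∀ᵐ ω ∂μ,
        |(μ[fun ω => outer (e₀ t ω) (e₀ t ω) i k | history x₀ ξ t]) ω
          - ∫ s, G xs s i * G xs s k ∂ν|
        ≤ c * m + (1 + 1 / c) * (2 * (4 * L ^ 2 * ‖x t ω - xs‖ ^ 2)
          + 2 * δ (x t ω - xs)) := fun t ht => by
      let B : Ω → ℝ := fun ω => c * ‖Φ t ω‖ ^ 2
        + (1 + 1 / c) * (2 * f (x t ω) (ξ t ω) + 2 * ‖Z t ω‖ ^ 2)
      have iΦ : Integrable (fun ω => ‖Φ t ω‖ ^ 2) μ := (hΦ2 t).integrable_norm_pow two_ne_zero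
      have iZ : Integrable (fun ω => ‖Z t ω‖ ^ 2) μ := (hZ2 t).integrable_norm_pow two_ne_zero
      have iB : Integrable B μ := (iΦ.const_mul c).add
        ((((hfi t).const_mul 2).add (iZ.const_mul 2)).const_mul _)
      have iprod : ∀ {u : Ω → Vec d}, MemLp u 2 μ → Integrable (fun ω => u ω i * u ω k) μ :=
        fun {u} hu => by
        have hj : ∀ j, MemLp (fun ω => u ω j) 2 μ := fun j =>
          hu.mono ((PiLp.continuous_apply 2 _ j).comp_aestronglyMeasurable hu.1)
            (Eventually.of_forall fun ω => abs_apply_le_norm _ _)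
        exact (hj i).integrable_mul (hj k)
      have ie := iprod (hdec.memLp t)
      have iP := iprod (hΦ2 t)
      have hpt : ∀ᵐ ω ∂μ, |e₀ t ω i * e₀ t ω k - Φ t ω i * Φ t ω k| ≤ B ω := by
        filter_upwards [hdec.decomp t] with ω hω
        refine (abs_mul_sub_mul_le hc i k).trans ?_
        have e : e₀ t ω + Φ t ω = (noise ν G η x₀ ξ t ω + Φ t ω) + -Z t ω := by
          rw [hω]; simp only [Z]; abel
        have h1 := norm_add_sq_le_two (noise ν G η x₀ ξ t ω + Φ t ω) (-Z t ω)
        rw [← e, norm_neg, ← hfD] at h1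
        simp only [B]
        gcongr
      have idiff : Integrable (fun ω => e₀ t ω i * e₀ t ω k - Φ t ω i * Φ t ω k) μ := ie.sub iP
      have up := condExp_mono (m := history x₀ ξ t) idiff iB
        (by filter_upwards [hpt] with ω h using (abs_le.1 h).2)
      have lo := condExp_mono (m := history x₀ ξ t) iB.neg idiff
        (by filter_upwards [hpt] with ω h using (abs_le.1 h).1)
      have eB : μ[B | history x₀ ξ t] =ᵐ[μ] fun ω =>
          c * (μ[fun ω => ‖Φ t ω‖ ^ 2 | history x₀ ξ t]) ω
            + (1 + 1 / c) * (2 * (μ[fun ω => f (x t ω) (ξ t ω) | history x₀ ξ t]) ω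
              + 2 * (μ[fun ω => ‖Z t ω‖ ^ 2 | history x₀ ξ t]) ω) := by
        have a1 := condExp_add (m := history x₀ ξ t) (iΦ.const_mul c)
          ((((hfi t).const_mul 2).add (iZ.const_mul 2)).const_mul (1 + 1 / c))
        have a2 := condExp_add (m := history x₀ ξ t) ((hfi t).const_mul 2) (iZ.const_mul 2)
        have a3 := condExp_smul (μ := μ) c (fun ω => ‖Φ t ω‖ ^ 2) (history x₀ ξ t)
        have a4 := condExp_smul (μ := μ) (1 + 1 / c)
          (fun ω => 2 * f (x t ω) (ξ t ω) + 2 * ‖Z t ω‖ ^ 2) (history x₀ ξ t)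
        have a5 := condExp_smul (μ := μ) (2 : ℝ) (fun ω => f (x t ω) (ξ t ω)) (history x₀ ξ t)
        have a6 := condExp_smul (μ := μ) (2 : ℝ) (fun ω => ‖Z t ω‖ ^ 2) (history x₀ ξ t)
        filter_upwards [a1, a2, a3, a4, a5, a6] with ω b1 b2 b3 b4 b5 b6
        simp only [Pi.add_apply, Pi.smul_apply, smul_eq_mul] at b1 b2 b3 b4 b5 b6
        refine b1.trans ?_
        refine congrArg₂ (· + ·) b3 (b4.trans ?_)
        refine congrArg _ (b2.trans ?_)
        exact congrArg₂ (· + ·) b5 b6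
      have esub := condExp_sub (m := history x₀ ξ t) ie iP
      have eΦ := hindep t (h := fun s => ‖G xs s‖ ^ 2) (hGxs.norm.pow_const 2)
      have eP := hindep t (h := fun s => G xs s i * G xs s k) ((hcoord i).mul (hcoord k))
      have ef := hdata.condExp_le t (measurable_iter hG η x₀ ξ t) hfm
        (fun y s => by positivity) (φ := fun y => 4 * L ^ 2 * ‖y - xs‖ ^ 2)
        (fun y => by positivity) hfle (hfi t)
      have eneg := condExp_neg (μ := μ) B (history x₀ ξ t)
      filter_upwards [up, lo, eB, esub, eΦ, eP, ef, eneg, hT t ht]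
        with ω h1 h2 h3 h4 h5 h6 h7 h8 h9
      change (μ[fun ω => e₀ t ω i * e₀ t ω k - Φ t ω i * Φ t ω k | history x₀ ξ t]) ω = _ at h4
      rw [h4] at h1 h2
      rw [h8] at h2
      simp only [Pi.sub_apply, Pi.neg_apply] at h1 h2
      change (μ[fun ω => Φ t ω i * Φ t ω k | history x₀ ξ t]) ω = _ at h6
      change (μ[fun ω => ‖Φ t ω‖ ^ 2 | history x₀ ξ t]) ω = _ at h5
      rw [h6] at h1 h2
      have h10 : (μ[B | history x₀ ξ t]) ω ≤ c * m + (1 + 1 / c) *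
          (2 * (4 * L ^ 2 * ‖x t ω - xs‖ ^ 2) + 2 * δ (x t ω - xs)) := by
        rw [h3, h5]
        gcongr
      change |(μ[fun ω => e₀ t ω i * e₀ t ω k | history x₀ ξ t]) ω - _| ≤ _
      refine abs_le.2 ⟨?_, ?_⟩ <;> linarith
    obtain ⟨n, hn, hlim⟩ := (hdec.covariance i k).exists_seq_tendsto_ae
    have hall := ae_all_iff.2 fun t : {t // T ≤ t} => hbound t.1 t.2
    obtain ⟨ω, hω1, hω2, hω3⟩ := (hlim.and (hall.and hconv)).exists
    have hn' := hn.tendsto_atTop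
    have hΔ : Tendsto (fun t => x t ω - xs) atTop (𝓝 0) := by
      simpa using hω3.sub_const xs
    have hrhs : Tendsto (fun t => c * m + (1 + 1 / c) * (2 * (4 * L ^ 2 * ‖x t ω - xs‖ ^ 2)
        + 2 * δ (x t ω - xs))) atTop (𝓝 (c * m)) := by
      have h1 := (((hΔ.norm.pow 2).const_mul (4 * L ^ 2)).const_mul 2).add
        ((hδ.comp hΔ).const_mul 2)
      simpa [Function.comp_def] using (h1.const_mul (1 + 1 / c)).const_add (c * m)
    refine le_of_tendsto_of_tendsto (hω1.sub_const _).abs (hrhs.comp hn') ?_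
    filter_upwards [hn'.eventually_ge_atTop T] with j hj
    exact hω2 ⟨n j, hj⟩
  rw [← sub_eq_zero, ← abs_nonpos_iff]
  refine le_of_forall_pos_le_add fun ε hε => ?_
  refine (hmain (ε / (m + 1)) (by positivity)).trans ?_
  rw [zero_add, div_mul_eq_mul_div, div_le_iff₀ (by positivity)]
  nlinarith

end Recursion

/-! ### Calculus of growth bounds for partial sums. -/

/-- The partial sums of `z` are `O(t^r log² t)`. -/
def SumBound (z : ℕ → ℝ) (r : ℝ) : Prop :=
  ∃ K, 0 ≤ K ∧ ∀ t : ℕ,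
    |∑ j ∈ Finset.range t, z j| ≤ K * (((t : ℝ) + 1) ^ r * Real.log ((t : ℝ) + 2) ^ 2)

namespace SumBound

variable {y z : ℕ → ℝ} {r r' : ℝ}

theorem mono (h : SumBound z r) (hr : r ≤ r') : SumBound z r' := by
  obtain ⟨K, hK, h⟩ := h
  refine ⟨K, hK, fun t => (h t).trans ?_⟩
  have : (1 : ℝ) ≤ (t : ℝ) + 1 := by linarith [(Nat.cast_nonneg t : (0 : ℝ) ≤ t)]
  gcongr

theorem add (hy : SumBound y r) (hz : SumBound z r) : SumBound (fun j => y j + z j) r := by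
  obtain ⟨K, hK, hy⟩ := hy
  obtain ⟨K', hK', hz⟩ := hz
  refine ⟨K + K', by positivity, fun t => ?_⟩
  rw [Finset.sum_add_distrib, add_mul]
  exact (abs_add_le _ _).trans (add_le_add (hy t) (hz t))

theorem of_log {K : ℝ} (hK : 0 ≤ K) (h : ∀ t : ℕ, |∑ j ∈ Finset.range t, z j|
    ≤ K * (((t : ℝ) + 1) ^ r * Real.log ((t : ℝ) + 2))) : SumBound z r := by
  have hl2 : 0 < Real.log 2 := Real.log_pos one_lt_two
  refine ⟨K / Real.log 2, by positivity, fun t => (h t).trans ?_⟩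
  have h2 : Real.log 2 ≤ Real.log ((t : ℝ) + 2) :=
    Real.log_le_log two_pos (by linarith [(Nat.cast_nonneg t : (0 : ℝ) ≤ t)])
  rw [div_mul_eq_mul_div, le_div_iff₀ hl2]
  have := log_add_two_pos t
  calc K * (((t : ℝ) + 1) ^ r * Real.log ((t : ℝ) + 2)) * Real.log 2
      ≤ K * (((t : ℝ) + 1) ^ r * Real.log ((t : ℝ) + 2)) * Real.log ((t : ℝ) + 2) := by gcongr
    _ = _ := by ring

theorem const (c : ℝ) : SumBound (fun _ => c) 1 := by
  have hl2 : 0 < Real.log 2 := Real.log_pos one_lt_two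
  refine of_log (K := |c| / Real.log 2) (by positivity) fun t => ?_
  have h2 : Real.log 2 ≤ Real.log ((t : ℝ) + 2) :=
    Real.log_le_log two_pos (by linarith [(Nat.cast_nonneg t : (0 : ℝ) ≤ t)])
  rw [Finset.sum_const, Finset.card_range, nsmul_eq_mul, abs_mul, Nat.abs_cast, Real.rpow_one,
    div_mul_eq_mul_div, le_div_iff₀ hl2]
  calc (t : ℝ) * |c| * Real.log 2 ≤ ((t : ℝ) + 1) * |c| * Real.log ((t : ℝ) + 2) := by
        gcongr
        linarith
    _ = _ := by ring

/-- Cauchy–Schwarz. -/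
theorem mul (hy : SumBound (fun j => y j ^ 2) r) (hz : SumBound (fun j => z j ^ 2) r') :
    SumBound (fun j => y j * z j) ((r + r') / 2) := by
  obtain ⟨K, hK, hy⟩ := hy
  obtain ⟨K', hK', hz⟩ := hz
  refine ⟨Real.sqrt (K * K'), by positivity, fun t => ?_⟩
  have ht : (0 : ℝ) < (t : ℝ) + 1 := by positivity
  have hl := log_add_two_pos t
  refine abs_le_of_sq_le_sq ?_ (by positivity)
  have h1 := Finset.sum_mul_sq_le_sq_mul_sq (Finset.range t) y z
  have h2 := (le_abs_self _).trans (hy t)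
  have h3 := (le_abs_self _).trans (hz t)
  refine h1.trans ((mul_le_mul h2 h3 (Finset.sum_nonneg fun j _ => sq_nonneg _)
    (by positivity)).trans (le_of_eq ?_))
  rw [mul_pow, Real.sq_sqrt (by positivity), mul_pow, ← Real.rpow_natCast (_ ^ ((r + r') / 2)),
    ← Real.rpow_mul ht.le]
  have : (r + r') / 2 * ((2 : ℕ) : ℝ) = r + r' := by push_cast; ring
  rw [this, Real.rpow_add ht]
  ring

/-- The third power of the logarithm turns the `O` bound with `log²` into `o`. Replacing `t + 1` and
`t + 2` by `t` costs a factor `2 * 2² = 8`. -/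
theorem isLittleO {ρ : ℝ} (hρ : ρ ≤ 1) (hρ0 : 0 ≤ ρ) (h : SumBound z (1 - ρ)) :
    (fun t : ℕ => (t : ℝ)⁻¹ * ∑ j ∈ Finset.range t, z j)
      =o[atTop] fun t : ℕ => (t : ℝ) ^ (-ρ) * Real.log (t : ℝ) ^ 3 := by
  obtain ⟨K, hK, h⟩ := h
  rw [Asymptotics.isLittleO_iff]
  intro c hc
  have hlog : Tendsto (fun t : ℕ => Real.log (t : ℝ)) atTop atTop :=
    Real.tendsto_log_atTop.comp tendsto_natCast_atTop_atTop
  filter_upwards [hlog.eventually_ge_atTop (8 * K / c), eventually_ge_atTop 2] with t ht ht2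
  have ht2' : (2 : ℝ) ≤ t := by exact_mod_cast ht2
  have ht0 : (0 : ℝ) < t := by linarith
  have hlt : 0 < Real.log (t : ℝ) := Real.log_pos (by linarith)
  rw [div_le_iff₀ hc] at ht
  rw [norm_mul, norm_mul, norm_inv, Real.norm_natCast, Real.norm_eq_abs,
    Real.norm_of_nonneg (by positivity : (0 : ℝ) ≤ (t : ℝ) ^ (-ρ)),
    Real.norm_of_nonneg (by positivity : (0 : ℝ) ≤ Real.log (t : ℝ) ^ 3)]
  have h1 : ((t : ℝ) + 1) ^ (1 - ρ) ≤ 2 * (t : ℝ) ^ (1 - ρ) := by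
    calc ((t : ℝ) + 1) ^ (1 - ρ) ≤ (2 * t) ^ (1 - ρ) := by
          apply Real.rpow_le_rpow <;> linarith
      _ = 2 ^ (1 - ρ) * (t : ℝ) ^ (1 - ρ) := Real.mul_rpow (by norm_num) ht0.le
      _ ≤ 2 ^ (1 : ℝ) * (t : ℝ) ^ (1 - ρ) := by
          gcongr
          · norm_num
          · linarith
      _ = _ := by rw [Real.rpow_one]
  have h2 : Real.log ((t : ℝ) + 2) ≤ 2 * Real.log t := by
    have : 2 * Real.log (t : ℝ) = Real.log ((t : ℝ) ^ 2) := by rw [Real.log_pow]; norm_num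
    rw [this]
    exact Real.log_le_log (by linarith) (by nlinarith)
  have h3 : (t : ℝ)⁻¹ * (t : ℝ) ^ (1 - ρ) = (t : ℝ) ^ (-ρ) := by
    rw [sub_eq_neg_add, Real.rpow_add ht0, Real.rpow_one]
    field_simp
  have hl := log_add_two_pos t
  calc (t : ℝ)⁻¹ * |∑ j ∈ Finset.range t, z j|
      ≤ (t : ℝ)⁻¹ * (K * ((2 * (t : ℝ) ^ (1 - ρ)) * (2 * Real.log t) ^ 2)) := by
        gcongr
        refine (h t).trans ?_
        gcongr
    _ = 8 * K * (((t : ℝ)⁻¹ * (t : ℝ) ^ (1 - ρ)) * Real.log t ^ 2) := by ring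
    _ = 8 * K * ((t : ℝ) ^ (-ρ) * Real.log t ^ 2) := by rw [h3]
    _ ≤ (Real.log t * c) * ((t : ℝ) ^ (-ρ) * Real.log t ^ 2) := by gcongr
    _ = _ := by ring

theorem isLittleO_average_sub {ρ c : ℝ} (hρ : ρ ≤ 1) (hρ0 : 0 ≤ ρ)
    (h : SumBound (fun j => z j - c) (1 - ρ)) :
    (fun t : ℕ => (t : ℝ)⁻¹ * ∑ j ∈ Finset.range t, z j - c)
      =o[atTop] fun t : ℕ => (t : ℝ) ^ (-ρ) * Real.log (t : ℝ) ^ 3 := by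
  refine (h.isLittleO hρ hρ0).congr' ?_ EventuallyEq.rfl
  filter_upwards [eventually_ge_atTop 1] with t ht
  have : (t : ℝ) ≠ 0 := by positivity
  simp only [Finset.sum_sub_distrib, Finset.sum_const, Finset.card_range, nsmul_eq_mul]
  field_simp

end SumBound

theorem tendsto_rpow_neg_mul_log_pow {ρ : ℝ} (hρ : 0 < ρ) (k : ℕ) :
    Tendsto (fun t : ℕ => (t : ℝ) ^ (-ρ) * Real.log (t : ℝ) ^ k) atTop (𝓝 0) := by
  have h1 := (isLittleO_log_rpow_rpow_atTop (k : ℝ) hρ).tendsto_div_nhds_zero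
  refine (h1.comp tendsto_natCast_atTop_atTop).congr' ?_
  filter_upwards with t
  simp only [Function.comp_apply, Real.rpow_natCast]
  rw [Real.rpow_neg (Nat.cast_nonneg t), div_eq_inv_mul]

/-! ### Entries, invertibility and perturbation of inverses. -/

section Matrices

theorem abs_entry_le_norm (M : Mat d) (i k : Fin d) : |M i k| ≤ ‖M‖ := by
  have h1 := Matrix.l2_opNorm_mulVec M (EuclideanSpace.single k (1 : ℝ))
  rw [PiLp.norm_single, norm_one, mul_one] at h1
  refine le_trans ?_ h1
  have := abs_apply_le_norm (WithLp.toLp 2 (M.mulVec (EuclideanSpace.single k (1 : ℝ)).ofLp)) i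
  simpa using this

theorem isLittleO_of_entries {M : ℕ → Mat d} {g : ℕ → ℝ}
    (h : ∀ i k, (fun t => M t i k) =o[atTop] g) : M =o[atTop] g := by
  have e : M = fun t => ∑ i, ∑ k, M t i k • Matrix.single i k (1 : ℝ) := by
    funext t
    conv_lhs => rw [Matrix.matrix_eq_sum_single (M t)]
    simp
  rw [e]
  refine Asymptotics.IsLittleO.fun_sum fun i _ => Asymptotics.IsLittleO.fun_sum fun k _ => ?_
  refine Asymptotics.IsBigO.trans_isLittleO ?_ (h i k)
  refine Asymptotics.IsBigO.of_bound ‖(Matrix.single i k (1 : ℝ) : Mat d)‖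
    (Eventually.of_forall fun t => ?_)
  rw [norm_smul, mul_comm]

theorem isUnit_of_spectrum_re_pos {H : Mat d}
    (h : ∀ z ∈ spectrum ℂ (H.map (algebraMap ℝ ℂ)), 0 < z.re) : IsUnit H := by
  have h0 : (0 : ℂ) ∉ spectrum ℂ (H.map (algebraMap ℝ ℂ)) := fun h' => by
    simpa using h 0 h'
  rw [spectrum.zero_notMem_iff, Matrix.isUnit_iff_isUnit_det] at h0
  rw [Matrix.isUnit_iff_isUnit_det]
  have e : (H.map (algebraMap ℝ ℂ)).det = algebraMap ℝ ℂ H.det :=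
    ((algebraMap ℝ ℂ).map_det H).symm
  rw [e] at h0
  simpa using h0

/-- Rates for `Ĥ` and `Ŝ` carry over to `Ĥ⁻¹ Ŝ Ĥ⁻¹`. -/
theorem isLittleO_inv_mul_mul_inv {A B : ℕ → Mat d} {H S : Mat d} (hH : IsUnit H) {g : ℕ → ℝ}
    (hg : Tendsto g atTop (𝓝 0)) (hA : (fun t => A t - H) =o[atTop] g)
    (hB : (fun t => B t - S) =o[atTop] g) :
    (∀ᶠ t in atTop, IsUnit (A t)) ∧
      (fun t => (A t)⁻¹ * B t * (A t)⁻¹ - H⁻¹ * S * H⁻¹) =o[atTop] g := by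
  have : CompleteSpace (Mat d) := FiniteDimensional.complete ℝ _
  have hAH : Tendsto A atTop (𝓝 H) := by
    simpa using (hA.trans_tendsto hg).add_const H
  have hBS : Tendsto B atTop (𝓝 S) := by
    simpa using (hB.trans_tendsto hg).add_const S
  have hunit : ∀ᶠ t in atTop, IsUnit (A t) :=
    hAH.eventually (Units.isOpen.mem_nhds hH)
  refine ⟨hunit, ?_⟩
  have hinv : Tendsto (fun t => (A t)⁻¹) atTop (𝓝 H⁻¹) := by
    obtain ⟨u, rfl⟩ := hH
    have := (NormedRing.inverse_continuousAt u).tendsto.comp hAH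
    simpa only [Function.comp_def, ← Matrix.nonsing_inv_eq_ringInverse] using this
  have hO1 : (fun t => (A t)⁻¹) =O[atTop] fun _ => (1 : ℝ) := hinv.isBigO_one ℝ
  have hO2 : B =O[atTop] fun _ => (1 : ℝ) := hBS.isBigO_one ℝ
  have hc : ∀ M : Mat d, (fun _ : ℕ => M) =O[atTop] fun _ => (1 : ℝ) := fun M =>
    Asymptotics.isBigO_const_const M one_ne_zero _
  -- Resolvent identity: the difference is `-(A t)⁻¹ (A t - H) H⁻¹`.
  have hdiff : (fun t => (A t)⁻¹ - H⁻¹) =o[atTop] g := by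
    have h1 := (hO1.mul_isLittleO hA.neg_left).mul_isBigO (hc H⁻¹)
    simp only [one_mul, mul_one] at h1
    refine h1.congr' ?_ EventuallyEq.rfl
    filter_upwards [hunit] with t ht
    have d1 := (Matrix.isUnit_iff_isUnit_det _).1 ht
    have d2 := (Matrix.isUnit_iff_isUnit_det _).1 hH
    rw [neg_sub, mul_sub, sub_mul, Matrix.nonsing_inv_mul _ d1, one_mul, mul_assoc,
      Matrix.mul_nonsing_inv _ d2, mul_one]
  -- Telescoping: the three factors are replaced one at a time, from left to right.
  have t1 := (hdiff.mul_isBigO hO2).mul_isBigO hO1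
  have t2 := ((hc H⁻¹).mul_isLittleO hB).mul_isBigO hO1
  have t3 := ((hc H⁻¹).mul (hc S)).mul_isLittleO hdiff
  simp only [one_mul, mul_one] at t1 t2 t3
  refine ((t1.add t2).add t3).congr_left fun t => ?_
  noncomm_ring

end Matrices

/-! ### Moments, and laws of large numbers along the recursion. -/

theorem memLp_of_lintegral_rpow_le {α : Type*} [MeasurableSpace α] {κ : Measure α}
    {E : Type*} [NormedAddCommGroup E] {f : α → E} (hf : AEStronglyMeasurable f κ) {r C : ℝ}
    (hr : 0 < r) (h : ∫⁻ s, ‖f s‖ₑ ^ r ∂κ ≤ ENNReal.ofReal C) :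
    MemLp f (ENNReal.ofReal r) κ := by
  refine ⟨hf, ?_⟩
  rw [eLpNorm_lt_top_iff_lintegral_rpow_enorm_lt_top (by simpa using hr) ENNReal.ofReal_ne_top,
    ENNReal.toReal_ofReal hr.le]
  exact h.trans_lt ENNReal.ofReal_lt_top

theorem memLp_two_mul_of_memLp_four {ν : Measure Ξ} {f : Ξ → Vec d} (hf : MemLp f 4 ν)
    (i k : Fin d) : MemLp (fun s => f s i * f s k) 2 ν := by
  have hm : ∀ j, AEStronglyMeasurable (fun s => f s j) ν := fun j =>
    (PiLp.continuous_apply 2 _ j).comp_aestronglyMeasurable hf.1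
  refine (memLp_two_iff_integrable_sq (f := fun s => (f s i * f s k : ℝ))
    ((hm i).mul (hm k))).2 ?_
  refine (hf.integrable_norm_pow (p := 4) (by norm_num)).mono (((hm i).mul (hm k)).pow 2)
    (Eventually.of_forall fun s => ?_)
  have h1 := abs_apply_le_norm (f s) i
  have h2 := abs_apply_le_norm (f s) k
  simp only [norm_pow, norm_mul, Real.norm_eq_abs, abs_norm]
  calc (|f s i| * |f s k|) ^ 2 ≤ (‖f s‖ * ‖f s‖) ^ 2 := by gcongr
    _ = _ := by ring

/-- Both alternatives contain `a < 1 - 1/p`. This secures a fourth moment of `G xs`, hence a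
variance for products of its coordinates. -/
theorem two_lt_of_rateCondition {lam p a LH : ℝ} (hp : 1 < p) (ha : 1 / 2 < a)
    (h : RateCondition lam p a LH) : 2 < p := by
  have h1 : a < (p - 1) / p := by
    rcases h with ⟨_, _, h⟩ | ⟨_, _, h⟩ <;> exact h
  rw [lt_div_iff₀ (by linarith)] at h1
  nlinarith

section Recursion

variable {μ : Measure Ω} [IsProbabilityMeasure μ] {ν : Measure Ξ} [IsProbabilityMeasure ν]
  {x₀ : Ω → Vec d} {ξ : ℕ → Ω → Ξ}

theorem IsDataStream.ae_sumBound (hdata : IsDataStream μ ν x₀ ξ) {φ : Ξ → ℝ}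
    (hφ : Measurable φ) {q : ℝ} (hq : 1 < q) (hq2 : q ≤ 2)
    (hmem : MemLp φ (ENNReal.ofReal q) ν) :
    ∀ᵐ ω ∂μ, SumBound (fun j => φ (ξ j ω) - ∫ s, φ s ∂ν) (1 / q) := by
  filter_upwards [hdata.ae_exists_abs_sum_sub_le hφ hq hq2 hmem] with ω ⟨K, hK, h⟩
  exact SumBound.of_log hK h

/-- Rate in the law of large numbers along the recursion for a scalar function `F` whose values
at `x_j` and at the root differ by a sequence of small squares. -/
theorem IsDataStream.ae_sumBound_sub (hdata : IsDataStream μ ν x₀ ξ) {x : ℕ → Ω → Vec d}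
    {xs : Vec d} {a ρ : ℝ} (hρa : ρ ≤ a / 2) {F : Vec d → Ξ → ℝ} (hF : Measurable (F xs))
    (hD : ∀ᵐ ω ∂μ, SumBound (fun j => (F (x j ω) (ξ j ω) - F xs (ξ j ω)) ^ 2) (1 - a))
    {q : ℝ} (hq : 1 < q) (hq2 : q ≤ 2) (hρq : ρ ≤ 1 - 1 / q)
    (hmem : MemLp (F xs) (ENNReal.ofReal q) ν) :
    ∀ᵐ ω ∂μ, SumBound (fun j => F (x j ω) (ξ j ω) - ∫ s, F xs s ∂ν) (1 - ρ) := by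
  filter_upwards [hD, hdata.ae_sumBound hF hq hq2 hmem] with ω h1 h2
  -- Cauchy–Schwarz against the constant `1`: the exponents `1 - a` and `1` average to `1 - a / 2`.
  have h3 := h1.mul (z := fun _ => 1) (r' := 1) (by simpa using SumBound.const 1)
  have h4 := (h3.mono (r' := 1 - ρ) (by linarith)).add (h2.mono (r' := 1 - ρ) (by linarith))
  simpa using h4

/-- Rate in the law of large numbers for a product of two coordinates of `G` along the
recursion. -/
theorem IsDataStream.ae_sumBound_mul_sub (hdata : IsDataStream μ ν x₀ ξ) {x : ℕ → Ω → Vec d}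
    {xs : Vec d} {a ρ : ℝ} (ha : 0 < a) (ha1 : a < 1) (hρa : ρ ≤ a / 2)
    {G : Vec d → Ξ → Vec d} (hG : Measurable (G xs)) (hG4 : MemLp (G xs) 4 ν)
    (hD : ∀ i, ∀ᵐ ω ∂μ,
      SumBound (fun j => (G (x j ω) (ξ j ω) i - G xs (ξ j ω) i) ^ 2) (1 - a)) (i k : Fin d) :
    ∀ᵐ ω ∂μ, SumBound (fun j => G (x j ω) (ξ j ω) i * G (x j ω) (ξ j ω) k
      - ∫ s, G xs s i * G xs s k ∂ν) (1 - ρ) := by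
  have hcoord : ∀ j, Measurable fun s => G xs s j := fun j =>
    (PiLp.continuous_apply 2 _ j).measurable.comp hG
  have hprod : ∀ i k, ∀ᵐ ω ∂μ, SumBound (fun j => G xs (ξ j ω) i * G xs (ξ j ω) k
      - ∫ s, G xs s i * G xs s k ∂ν) (1 / 2) := fun i k =>
    hdata.ae_sumBound ((hcoord i).mul (hcoord k)) one_lt_two le_rfl
      (by rw [ENNReal.ofReal_ofNat]; exact memLp_two_mul_of_memLp_four hG4 i k)
  have hsq : ∀ i, ∀ᵐ ω ∂μ, SumBound (fun j => G xs (ξ j ω) i ^ 2) 1 := fun i => by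
    filter_upwards [hprod i i] with ω h
    have := (h.mono (r' := 1) (by norm_num)).add (SumBound.const (∫ s, G xs s i * G xs s i ∂ν))
    simpa [sq] using this
  filter_upwards [hD i, hD k, hsq i, hsq k, hprod i k] with ω d1 d2 s1 s2 h
  -- Expansion of the product around the root: the product of the differences has exponent `1 - a`,
  -- the mixed terms `1 - a / 2`, and the fluctuation at the root `1 / 2`.
  have t1 := (d1.mul d2).mono (r' := 1 - ρ) (by linarith)
  have t2 := (d1.mul s2).mono (r' := 1 - ρ) (by linarith)
  have t3 := (s1.mul d2).mono (r' := 1 - ρ) (by linarith)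
  have t4 := h.mono (r' := 1 - ρ) (by linarith)
  convert ((t1.add t2).add t3).add t4 using 2 with j
  ring

end Recursion

end SA

end

/-! ### Assembly of the rates. -/

theorem mainTheorem7 {d : ℕ} {Ω Ξ : Type*} [MeasurableSpace Ω] [MeasurableSpace Ξ]
    (μ : Measure Ω) [IsProbabilityMeasure μ] (ν : Measure Ξ) [IsProbabilityMeasure ν]
    (x₀ : Ω → SA.Vec d) (ξ : ℕ → Ω → Ξ) (hdata : SA.IsDataStream μ ν x₀ ξ)
    (G : SA.Vec d → Ξ → SA.Vec d) (hG : Measurable (Function.uncurry G))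
    (xs : SA.Vec d) (hroot : SA.meanField ν G xs = 0)
    (H S : SA.Mat d) (LH lam p a η₀ : ℝ)
    (hlyap : SA.HasLyapunov (SA.meanField ν G) xs)
    (hlin : SA.IsLocallyLinear (SA.meanField ν G) xs H LH lam)
    (hlip : SA.IsMeanSquareLipschitz ν G)
    (hη₀ : 0 < η₀) (ha : 1 / 2 < a) (ha1 : a < 1)
    (hnoise : SA.NoiseCondition μ ν G (SA.stepSize η₀ a) x₀ ξ xs S p)
    (hrate : SA.RateCondition lam p a LH)
    (Hbar : SA.Vec d → Ξ → SA.Mat d)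
    (hHbar : ∀ i k, Measurable fun q : SA.Vec d × Ξ => Hbar q.1 q.2 i k)
    (pbar : ℝ) (hunb : SA.IsUnbiasedEstimate ν Hbar xs H pbar)
    (hlipH : SA.IsMeanSquareLipschitz ν Hbar) :
    (∀ᵐ ω ∂μ, ∀ᶠ t in atTop,
      IsUnit (SA.hatH Hbar (SA.iter G (SA.stepSize η₀ a) x₀ ξ) ξ t ω)) ∧
    SA.IsSoftLittleOAS μ
      (fun t ω =>
        (SA.hatH Hbar (SA.iter G (SA.stepSize η₀ a) x₀ ξ) ξ t ω)⁻¹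
            * SA.hatS G (SA.iter G (SA.stepSize η₀ a) x₀ ξ) ξ t ω
            * (SA.hatH Hbar (SA.iter G (SA.stepSize η₀ a) x₀ ξ) ξ t ω)⁻¹
          - H⁻¹ * S * H⁻¹)
      (fun t => (t : ℝ) ^ (-min (1 - 1 / pbar) (a / 2))) := by
  obtain ⟨V, hV, hV0, ⟨μV, hμV, hVlow⟩, ⟨LV, hLV, hVlip⟩, hpos, δ, hδ, lV, hlV, hloc⟩ := hlyap
  obtain ⟨L, hL, hlip⟩ := hlip
  obtain ⟨LB, hLB, hlipH⟩ := hlipH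
  obtain ⟨hpb, hHmem, hHint⟩ := hunb
  obtain ⟨Cε, hmom, hmomG⟩ := hnoise.moment
  obtain ⟨e₀, ζ, hdec⟩ := hnoise.decomposition
  have hp2 : 2 < p := SA.two_lt_of_rateCondition hnoise.one_lt ha hrate
  have ha0 : 0 < a := by linarith
  set η := SA.stepSize η₀ a with hη
  set x := SA.iter G η x₀ ξ with hx
  set ρ := min (1 - 1 / pbar) (a / 2) with hρ
  have hpb' : 1 / pbar < 1 := (div_lt_one (by linarith)).2 hpb
  have hρ0 : 0 < ρ := lt_min (by linarith) (by linarith)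
  have hρa : ρ ≤ a / 2 := min_le_right _ _
  have hρ1 : ρ ≤ 1 := by linarith
  have hVlow' : ∀ y, μV * ‖y‖ ^ 2 ≤ V y := fun y => by simpa using hVlow (y + xs)
  have hpos' : ∀ y, 0 ≤ inner ℝ (gradient V (y - xs)) (SA.meanField ν G y) := fun y => by
    by_cases hy : y = xs
    · simp [hy, hroot]
    · exact (hpos y hy).le
  have hGxs : Measurable (G xs) := hG.comp measurable_prodMk_left
  have hGp : MemLp (G xs) (ENNReal.ofReal (2 * p)) ν :=
    SA.memLp_of_lintegral_rpow_le hGxs.aestronglyMeasurable (by linarith) hmomG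
  have h4 : (4 : ENNReal) ≤ ENNReal.ofReal (2 * p) := by
    rw [← ENNReal.ofReal_ofNat 4]
    exact ENNReal.ofReal_le_ofReal (by norm_num; linarith)
  have hG4 : MemLp (G xs) 4 ν := hGp.mono_exponent h4
  have h24 : (2 : ENNReal) ≤ 4 := by norm_num
  have hG2 : MemLp (G xs) 2 ν := hG4.mono_exponent h24
  have hgm : Measurable (SA.meanField ν G) := (SA.continuous_of_norm_sub_le hL.le
    (SA.norm_meanField_sub_le hG hL.le hlip hG2)).measurable
  have hxm : ∀ t, Measurable (x t) := fun t =>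
    (SA.measurable_iter hG η x₀ ξ t).mono (hdata.history_le t) le_rfl
  have hnoise2 : ∀ t, MemLp (SA.noise ν G η x₀ ξ t) 2 μ := fun t => by
    have hm : Measurable (SA.noise ν G η x₀ ξ t) :=
      (hgm.comp (hxm t)).sub (hG.comp ((hxm t).prodMk (hdata.measurable_data t)))
    exact (SA.memLp_of_lintegral_rpow_le hm.aestronglyMeasurable (by linarith)
      (hmom t)).mono_exponent (h24.trans h4)
  have hconv : ∀ᵐ ω ∂μ, Tendsto (fun t => x t ω) atTop (𝓝 xs) :=
    hdata.ae_tendsto_iter hG hroot hL.le hlip hG2 hV hV0 hμV hVlow' hLV.le hVlip hpos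
      (fun t => (SA.stepSize_pos hη₀ t).le) (SA.not_summable_stepSize hη₀ ha1)
      (SA.summable_stepSize_sq ha)
  have hS : ∀ i k, S i k = ∫ s, G xs s i * G xs s k ∂ν :=
    hdata.covariance_eq hG hroot hL.le hlip hG2 hconv hnoise2 hdec
  have hclose := hdata.exists_lintegral_stayClose_le hG hL.le hlip hG2 hV hV0 hμV hVlow' hLV.le
    hVlip hpos' hlV hloc hη₀ ha0 ha1
  have hsq : ∀ {F : SA.Vec d → Ξ → ℝ}, Measurable (Function.uncurry F) → ∀ {L' : ℝ}, 0 ≤ L' →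
      (∀ y z, eLpNorm (fun s => F y s - F z s) 2 ν ≤ ENNReal.ofReal (L' * ‖y - z‖)) →
      ∀ᵐ ω ∂μ, SA.SumBound (fun j => (F (x j ω) (ξ j ω) - F xs (ξ j ω)) ^ 2) (1 - a) := by
    intro F hF L' hL' hlipF
    filter_upwards [hdata.ae_exists_sum_sq_le hG hδ hη₀ ha0 ha1 hconv hclose hF hL' hlipF]
      with ω ⟨K, hK, h⟩
    refine ⟨K, hK, fun t => ?_⟩
    rw [abs_of_nonneg (Finset.sum_nonneg fun j _ => sq_nonneg _)]
    exact h t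
  have hSrate : ∀ i k, ∀ᵐ ω ∂μ, (fun t => (SA.hatS G x ξ t ω - S) i k)
      =o[atTop] fun t : ℕ => (t : ℝ) ^ (-ρ) * Real.log (t : ℝ) ^ 3 := fun i k => by
    have hD : ∀ i, ∀ᵐ ω ∂μ,
        SA.SumBound (fun j => (G (x j ω) (ξ j ω) i - G xs (ξ j ω) i) ^ 2) (1 - a) := fun i =>
      hsq (F := fun y s => G y s i) ((PiLp.continuous_apply 2 _ i).measurable.comp hG) hL.le
        fun y z => (eLpNorm_mono fun s => by
          simpa using SA.abs_apply_le_norm (G y s - G z s) i).trans (hlip y z)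
    filter_upwards [hdata.ae_sumBound_mul_sub ha0 ha1 hρa hGxs hG4 hD i k] with ω h
    rw [← hS i k] at h
    refine (h.isLittleO_average_sub hρ1 hρ0.le).congr_left fun t => ?_
    simp [SA.hatS, SA.outer, Matrix.sum_apply]
  have hHrate : ∀ i k, ∀ᵐ ω ∂μ, (fun t => (SA.hatH Hbar x ξ t ω - H) i k)
      =o[atTop] fun t : ℕ => (t : ℝ) ^ (-ρ) * Real.log (t : ℝ) ^ 3 := fun i k => by
    let ev : SA.Mat d →L[ℝ] ℝ := (Matrix.entryLinearMap ℝ ℝ i k).toContinuousLinearMap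
    have hmean : ∫ s, Hbar xs s i k ∂ν = H i k := by
      rw [← hHint]
      exact ev.integral_comp_comm (hHmem.integrable (by simpa using hpb.le))
    have hmem : MemLp (fun s => Hbar xs s i k) (ENNReal.ofReal (min pbar 2)) ν :=
      (ev.comp_memLp' hHmem).mono_exponent (ENNReal.ofReal_le_ofReal (min_le_left _ _))
    have hq : 1 < min pbar 2 := lt_min hpb one_lt_two
    -- Capping the moment order at `2` costs nothing: for `pbar ≥ 2` the fluctuation exponent is `1
    -- / 2`, which exceeds `a / 2`.
    have hρq : ρ ≤ 1 - 1 / min pbar 2 := by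
      rcases le_total pbar 2 with h | h
      · rw [min_eq_left h]; exact min_le_left _ _
      · rw [min_eq_right h]; linarith
    have hD := hsq (F := fun y s => Hbar y s i k) (hHbar i k) hLB.le fun y z =>
      (eLpNorm_mono fun s => by
        simpa using SA.abs_entry_le_norm (Hbar y s - Hbar z s) i k).trans (hlipH y z)
    filter_upwards [hdata.ae_sumBound_sub (x := x) (xs := xs) hρa (F := fun y s => Hbar y s i k)
      ((hHbar i k).comp measurable_prodMk_left) hD hq (min_le_right _ _) hρq hmem] with ω h
    rw [hmean] at h
    refine (h.isLittleO_average_sub hρ1 hρ0.le).congr_left fun t => ?_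
    simp [SA.hatH, Matrix.sum_apply]
  have hfinal : ∀ᵐ ω ∂μ, (∀ᶠ t in atTop, IsUnit (SA.hatH Hbar x ξ t ω)) ∧
      (fun t => (SA.hatH Hbar x ξ t ω)⁻¹ * SA.hatS G x ξ t ω * (SA.hatH Hbar x ξ t ω)⁻¹
        - H⁻¹ * S * H⁻¹) =o[atTop] fun t : ℕ => (t : ℝ) ^ (-ρ) * Real.log (t : ℝ) ^ 3 := by
    filter_upwards [ae_all_iff.2 fun i => ae_all_iff.2 (hSrate i),
      ae_all_iff.2 fun i => ae_all_iff.2 (hHrate i)] with ω h1 h2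
    exact SA.isLittleO_inv_mul_mul_inv (SA.isUnit_of_spectrum_re_pos hlin.2.2.2.2)
      (SA.tendsto_rpow_neg_mul_log_pow hρ0 3) (SA.isLittleO_of_entries h2)
      (SA.isLittleO_of_entries h1)
  exact ⟨hfinal.mono fun ω h => h.1, 3, hfinal.mono fun ω h => h.2⟩
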